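/- **Setting.** Let $\varphi$ be the standard normal density, and for a probability measure $G$ on $\mathbb R$ let $f_G(u)=\int\varphi(u-\mu)\,dG(\mu)$. Let $\mathcal G$ be a convex set of probability measures on $\mathbb R$, $G\in\mathcal G$ the true effect size distribution, $M>0$ and $x\in\mathbb R$ fixed, and $h:\mathbb R\to\mathbb R$ measurable with $h\,\varphi(x-\cdot)$ integrable under every element of $\mathcal G$. Write $A_G=\int h(\mu)\varphi(x-\mu)\,dG(\mu)$, $F_G=f_G(x)$; the estimand is $\theta_G(x)=A_G/F_G=E_G[h(\mu)\mid X=x]$, where $\mu\sim G$ and $X\mid\mu\sim N(\mu,1)$. For each $m$ one observes two independent folds $\tilde X_1,\dots,\tilde X_m$ and $X_1,\dots,X_m$, all i.i.d. with density $f_G$. From the first fold one computes (measurably) an integrable function $\bar f_m:\mathbb R\to\mathbb R$, a radius $c_m\ge0$, a number $\delta_m>0$, pilots $\bar A_m,\bar F_m$, a tuning parameter $\Gamma_m$, a number $Q_0$ and a function $Q:\mathbb R\to\mathbb R$. Put $\bar\theta=\bar A_m/\bar F_m$ and define the linearized target, for $\tilde G\in\mathcal G$, as $$\Delta_{\tilde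 G}(x)=\frac{A_{\tilde G}-\bar\theta F_{\tilde G}}{\bar F_m}.$$ Let $\|u\|_{\infty,M}=\max\{\sup_{|y|\le M}|u(y)|,\ |\int_{-\infty}^{-M}u|,\ |\int_M^\infty u|\}$ and $\mathcal G_m=\{\tilde G\in\mathcal G:\|f_{\tilde G}-\bar f_m\|_{\infty,M}\le c_m\}$. The modulus of continuity $\omega_m(\delta)$ is the supremum of $\Delta_{G_1}(x)-\Delta_{G_{-1}}(x)$ over $G_1,G_{-1}\in\mathcal G_m$ with $$\frac{\big(\int_{-\infty}^{-M}(f_{G_1}-f_{G_{-1}})\big)^2}{\int_{-\infty}^{-M}\bar f_m}+\int_{-M}^{M}\frac{(f_{G_1}-f_{G_{-1}})^2}{\bar f_m}+\frac{\big(\int_{M}^{\infty}(f_{G_1}-f_{G_{-1}})\big)^2}{\int_{M}^{\infty}\bar f_m}\le\delta^2 .$$ For an affine estimator given by $(Q_0,Q)$ let $\mathrm{Bias}_{\tilde G}=Q_0+E_{\tilde G}[Q(X)]-\Delta_{\tilde G}(x)$, and put $$\hat\Delta=Q_0+\frac1m\sum_{i=1}^mQ(X_i),\qquad \hat B^2=\sup_{\tilde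 G\in\mathcal G_m}\mathrm{Bias}_{\tilde G}^2,\qquad \hat V=\frac1{m(m-1)}\Big[\sum_i Q(X_i)^2-\frac1m\Big(\sum_iQ(X_i)\Big)^2\Big],$$ $$\hat t_\alpha(B,V)=\inf\{t:\ P(|b+V^{1/2}Z|>t)<\alpha\ \text{ for all } |b|\le B\},\quad Z\sim N(0,1),\qquad \hat\theta(x)=\bar\theta+\hat\Delta .$$ **Theorem.** Assume the following, where "with high probability" means with probability tending to $1$ as $m\to\infty$ under $G$. 1. (a) With high probability $\sup_{\tilde G\in\mathcal G}|\Delta_{\tilde G}(x)|<\infty$. (b) With high probability $\|f_G-\bar f_m\|_{\infty,M}\le c_m$. (c) $c_m\to0$ in probability. (d) With high probability $\Gamma_m=m^{-1}\omega_m'(\delta_m)^2$ for some element $\omega_m'(\delta_m)$ of the superdifferential of $\omega_m$ at $\delta_m$; and $c_m^2/(m\delta_m^2)\to0$ in probability. (e) With high probability the supremum defining $\omega_m(\delta_m)$ is attained. (f) With high probability $(Q_0,Q)$ minimizes $\sup_{\tilde G\in\mathcal G_m}\mathrm{Bias}_{\tilde G}^2$ over all $(Q_0,Q)$ such that $Q$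 is constant on $(-\infty,-M]$ and constant on $[M,\infty)$, $E_{\tilde G}|Q(X)|<\infty$ for all $\tilde G\in\mathcal G_m$, $Q^2\bar f_m$ is integrable and $\frac1m\int Q^2\bar f_m\le\Gamma_m$. 2. The pilots satisfy $\limsup_{m}\frac{m}{\sqrt{\log m}}E_G(F_G-\bar F_m)^2<\infty$ and $\limsup_{m}\sqrt{\log m}\;E_G(A_G-\bar A_m)^2=0$. 3. There is $C>0$ such that with high probability $\omega_m^2(2/\sqrt m)\ge C/m$. Then for every $\eta>0$ and $\alpha\in(0,1)$, $$\liminf_{m\to\infty}P_G\Big(\big|\theta_G(x)-\hat\theta(x)\big|\le(1+\eta)\,\hat t_\alpha(\hat B,\hat V)\Big)\ge1-\alpha .$$ -/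

import Mathlib

open MeasureTheory ProbabilityTheory Filter Topology
open scoped ENNReal NNReal

namespace MCEB

noncomputable section

/-! ### The model -/

/-- The marginal density `f_G = φ ⋆ dG` of `X`, when `μ ∼ G` and `X ∣ μ ∼ N(μ, 1)`. -/
def marginalDensity (G : Measure ℝ) (u : ℝ) : ℝ :=
  ∫ μ, gaussianPDFReal 0 1 (u - μ) ∂G

/-- The law on `ℝ` of one observation, with Lebesgue density `f_G`. -/
def sampleLaw (G : Measure ℝ) : Measure ℝ :=
  volume.withDensity fun u => ENNReal.ofReal (marginalDensity G u)

/-- The law of a fold of `m` i.i.d. observations with density `f_G`. -/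
def foldLaw (G : Measure ℝ) (m : ℕ) : Measure (Fin m → ℝ) :=
  Measure.pi fun _ => sampleLaw G

/-- The joint law of two independent folds of size `m`: the first component is the fold from which
the pilots are built, the second is the fold on which the linear estimator is evaluated. -/
def twoFoldLaw (G : Measure ℝ) (m : ℕ) : Measure ((Fin m → ℝ) × (Fin m → ℝ)) :=
  (foldLaw G m).prod (foldLaw G m)

/-! ### Probabilities and limits in probability -/

/-- The (inner) probability of an event. It is `P E` for every measurable event, and it is the
conservative reading for an event whose measurability is not known. -/
def prob {Ω : Type*} [MeasurableSpace Ω] (P : Measure Ω) (E : Set Ω) : ℝ≥0∞ :=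
  1 - P Eᶜ

theorem prob_eq {Ω : Type*} [MeasurableSpace Ω] (P : Measure Ω) [IsProbabilityMeasure P]
    {E : Set Ω} (hE : MeasurableSet E) : prob P E = P E := by
  rw [prob, ← prob_compl_eq_one_sub hE.compl, compl_compl]

/-- The event `E m`, which depends on the first fold, has probability tending to one. -/
def WithHighProb (G : Measure ℝ) (E : ∀ m : ℕ, (Fin m → ℝ) → Prop) : Prop :=
  Tendsto (fun m => prob (foldLaw G m) {xt | E m xt}) atTop (𝓝 1)

/-- The statistic `T m` of the first fold tends to zero in probability. -/
def TendstoZeroInProb (G : Measure ℝ) (T : ∀ m : ℕ, (Fin m → ℝ) → ℝ) : Prop :=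
  ∀ ε : ℝ, 0 < ε → WithHighProb G fun m xt => |T m xt| ≤ ε

/-- The mean squared error `E_G (a - T)²` of a statistic `T` of the first fold. -/
def mse (G : Measure ℝ) (m : ℕ) (a : ℝ) (T : (Fin m → ℝ) → ℝ) : ℝ≥0∞ :=
  ∫⁻ xt, ENNReal.ofReal ((a - T xt) ^ 2) ∂(foldLaw G m)

/-! ### Localization and modulus of continuity -/

/-- The norm `‖u‖_{∞,M}`: the largest of `sup_{|x| ≤ M} |u x|`, `|∫_{-∞}^{-M} u|`,
`|∫_M^∞ u|`. -/
def supTailNorm (M : ℝ) (u : ℝ → ℝ) : ℝ≥0∞ :=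
  max (⨆ x ∈ Set.Icc (-M) M, ‖u x‖ₑ)
    (max ‖∫ x in Set.Iic (-M), u x‖ₑ ‖∫ x in Set.Ici M, u x‖ₑ)

/-- The distributions of `𝒢` whose marginal density is within `c` of the pilot `fbar`. -/
def localization (M : ℝ) (𝒢 : Set (Measure ℝ)) (fbar : ℝ → ℝ) (c : ℝ) : Set (Measure ℝ) :=
  {G | G ∈ 𝒢 ∧ supTailNorm M (fun u => marginalDensity G u - fbar u) ≤ ENNReal.ofReal c}

/-- The weighted squared distance between two marginal densities that constrains the modulus
problem; each of the two tails enters as one cell. -/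
def chiSqDist (M : ℝ) (fbar : ℝ → ℝ) (G₁ G₂ : Measure ℝ) : ℝ :=
  (∫ u in Set.Iic (-M), (marginalDensity G₁ u - marginalDensity G₂ u)) ^ 2
      / (∫ u in Set.Iic (-M), fbar u)
    + (∫ u in Set.Icc (-M) M, (marginalDensity G₁ u - marginalDensity G₂ u) ^ 2 / fbar u)
    + (∫ u in Set.Ici M, (marginalDensity G₁ u - marginalDensity G₂ u)) ^ 2
      / (∫ u in Set.Ici M, fbar u)

/-- The modulus of continuity `ω(δ)` of the functional `L` over the class `𝒢m`. -/
def modulus (M : ℝ) (𝒢m : Set (Measure ℝ)) (fbar : ℝ → ℝ) (L : Measure ℝ → ℝ) (δ : ℝ) : ℝ :=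
  sSup {r | ∃ G₁ ∈ 𝒢m, ∃ G₂ ∈ 𝒢m, chiSqDist M fbar G₁ G₂ ≤ δ ^ 2 ∧ r = L G₁ - L G₂}

/-- The modulus problem at `δ` has a solution. -/
def ModulusAttained (M : ℝ) (𝒢m : Set (Measure ℝ)) (fbar : ℝ → ℝ) (L : Measure ℝ → ℝ)
    (δ : ℝ) : Prop :=
  ∃ G₁ ∈ 𝒢m, ∃ G₂ ∈ 𝒢m, chiSqDist M fbar G₁ G₂ ≤ δ ^ 2 ∧
    L G₁ - L G₂ = modulus M 𝒢m fbar L δ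

/-- `s` lies in the superdifferential at `δ` of the function `w` on `(0, ∞)`. -/
def IsSupergradient (w : ℝ → ℝ) (δ s : ℝ) : Prop :=
  ∀ t : ℝ, 0 < t → w t ≤ w δ + s * (t - δ)

/-! ### Linear estimators, their worst-case bias, and the minimax problem -/

/-- The bias `Q₀ + E_G[Q(X)] - L(G)` of the linear estimator with offset `Q₀` and weights `Q`. -/
def bias (Q₀ : ℝ) (Q : ℝ → ℝ) (L : Measure ℝ → ℝ) (G : Measure ℝ) : ℝ :=
  Q₀ + (∫ u, Q u ∂(sampleLaw G)) - L G

/-- The worst-case squared bias over `𝒢m`. -/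
def worstSqBias (𝒢m : Set (Measure ℝ)) (L : Measure ℝ → ℝ) (Q₀ : ℝ) (Q : ℝ → ℝ) : ℝ≥0∞ :=
  ⨆ G ∈ 𝒢m, ENNReal.ofReal (bias Q₀ Q L G ^ 2)

/-- The worst-case bias `B̂`, with `B̂² = sup_{G ∈ 𝒢m} bias(G)²`. -/
def worstBias (𝒢m : Set (Measure ℝ)) (L : Measure ℝ → ℝ) (Q₀ : ℝ) (Q : ℝ → ℝ) : ℝ :=
  √(worstSqBias 𝒢m L Q₀ Q).toReal

/-- Admissible weight functions: constant on each tail, with a finite mean under every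
distribution of `𝒢m`, and with variance proxy `m⁻¹ ∫ Q² fbar ≤ Γ`. -/
structure IsFeasible (M : ℝ) (𝒢m : Set (Measure ℝ)) (fbar : ℝ → ℝ) (m : ℕ) (Γ : ℝ)
    (Q : ℝ → ℝ) : Prop where
  measurable : Measurable Q
  left_tail : ∀ u ≤ -M, Q u = Q (-M)
  right_tail : ∀ u ≥ M, Q u = Q M
  integrable : ∀ G ∈ 𝒢m, Integrable Q (sampleLaw G)
  integrable_sq : Integrable fun u => Q u ^ 2 * fbar u
  variance_le : (1 / (m : ℝ)) * ∫ u, Q u ^ 2 * fbar u ≤ Γ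

/-- `(Q₀, Q)` minimizes the worst-case squared bias over `𝒢m` among the affine estimators whose
weights are admissible. -/
def IsMinimax (M : ℝ) (𝒢m : Set (Measure ℝ)) (fbar : ℝ → ℝ) (L : Measure ℝ → ℝ) (m : ℕ) (Γ : ℝ)
    (Q₀ : ℝ) (Q : ℝ → ℝ) : Prop :=
  IsFeasible M 𝒢m fbar m Γ Q ∧
    ∀ (Q₀' : ℝ) (Q' : ℝ → ℝ), IsFeasible M 𝒢m fbar m Γ Q' →
      worstSqBias 𝒢m L Q₀ Q ≤ worstSqBias 𝒢m L Q₀' Q'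

/-- The estimate `Q₀ + m⁻¹ ∑ Q(Xᵢ)`. -/
def linearEstimate {m : ℕ} (Q₀ : ℝ) (Q : ℝ → ℝ) (X : Fin m → ℝ) : ℝ :=
  Q₀ + (1 / (m : ℝ)) * ∑ i, Q (X i)

/-- The estimated variance `V̂` of the linear estimate. -/
def varianceEstimate {m : ℕ} (Q : ℝ → ℝ) (X : Fin m → ℝ) : ℝ :=
  1 / ((m : ℝ) * ((m : ℝ) - 1)) * (∑ i, Q (X i) ^ 2 - (∑ i, Q (X i)) ^ 2 / (m : ℝ))

/-- The bias-aware half-width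
`t̂_α(B, V) = inf {t : P(|b + V^{1/2} Z| > t) < α for all |b| ≤ B}`, `Z ∼ N(0, 1)`. -/
def halfWidth (α B V : ℝ) : ℝ :=
  sInf {t : ℝ | ∀ b : ℝ, |b| ≤ B →
    gaussianReal 0 1 {z : ℝ | t < |b + √V * z|} < ENNReal.ofReal α}

/-! ### The empirical Bayes estimand and its linearization -/

/-- The numerator `A_G = ∫ h(μ) φ(x - μ) dG(μ)`. -/
def numerator (h : ℝ → ℝ) (x : ℝ) (G : Measure ℝ) : ℝ :=
  ∫ μ, h μ * gaussianPDFReal 0 1 (x - μ) ∂G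

/-- The denominator `F_G = ∫ φ(x - μ) dG(μ) = f_G(x)`. -/
def denominator (x : ℝ) (G : Measure ℝ) : ℝ :=
  marginalDensity G x

/-- The empirical Bayes estimand `θ_G(x) = E_G[h(μ) ∣ X = x] = A_G / F_G`. -/
def posteriorExpectation (h : ℝ → ℝ) (x : ℝ) (G : Measure ℝ) : ℝ :=
  numerator h x G / denominator x G

/-- The linearized target `Δ_G(x) = (A_G - θ̄ F_G) / F̄`, with `θ̄ = Ā / F̄`. -/
def calibrationTarget (h : ℝ → ℝ) (x Abar Fbar : ℝ) (G : Measure ℝ) : ℝ :=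
  (numerator h x G - Abar / Fbar * denominator x G) / Fbar

/-- The inflated interval `θ̂(x) ± (1 + η) t̂_α(B̂, V̂)`, with `θ̂(x) = θ̄ + Δ̂(x)`. -/
def inflatedInterval (α η : ℝ) (𝒢m : Set (Measure ℝ)) (h : ℝ → ℝ) (x Abar Fbar : ℝ)
    (Q₀ : ℝ) (Q : ℝ → ℝ) {m : ℕ} (X : Fin m → ℝ) : Set ℝ :=
  let θhat := Abar / Fbar + linearEstimate Q₀ Q X
  let t := halfWidth α (worstBias 𝒢m (calibrationTarget h x Abar Fbar) Q₀ Q)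
    (varianceEstimate Q X)
  Set.Icc (θhat - (1 + η) * t) (θhat + (1 + η) * t)

end

end MCEB

/-!
The interval covers because, given the first fold, the error of `θ̂(x)` is a bias bounded by `B̂`,
plus a nearly Gaussian noise whose variance `V̂` estimates consistently, plus a linearization
error of smaller order than the half-width.

*Linearization.* The difference between `θ_G(x) - θ̄` and `Δ_G(x)` is of second order in the
errors of the pilots, and the two rates make it `o_P(m^{-1/2})` (`withHighProb_linearization`).

*The minimax weights.* On weight functions constant on the tails, `∫ Q R fbar` is an inner product
in which `Q ↦ E_{G₁} Q - E_{G₂} Q` is represented by the score of the pair `(G₁, G₂)`, and the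
squared distance in the modulus problem is the squared norm of the score. If `s` is a
supergradient of the modulus `ω` at `δ`, then moving from the extremal pair along a segment
towards any other pair shows that the weights `(s / δ) · score` have worst-case bias at most
`(ω(δ) - s δ) / 2` (`LocalProblem.sub_le_of_isSupergradient`). A minimax `Q` does no worse at the
extremal pair, which forces equality in the Cauchy-Schwarz inequality, so that `Q` is almost
everywhere this multiple of the score (`LocalProblem.minimax_eq_pairScore`). The localization
bounds scores by a multiple of `c_m`, so `Q` is bounded by a multiple of `c_m / δ_m` times its
standard deviation `σ`; this is `o_P(√m) σ`. The supporting line at `δ` also yields `ω(2 / √m) ≤ 2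
B̂ + 4 σ / √m`, so that `B̂ + σ / √m` is at least of order `m^{-1/2}`
(`LocalProblem.minimax_bounds`).

*Noise.* For weights bounded by a small multiple of `√m σ`, the centred sample mean is nearly
normal uniformly in the weights, by a third-order Taylor bound on characteristic functions, Lévy's
continuity theorem and the Lévy-Prokhorov metric; the sample variance is consistent by Chebyshev's
inequality (`exists_noise_bounds`).

*Half-width.* The half-width is at least a constant times `B̂ + √V̂`, and it dominates the
`α`-quantile of `|b + s Z|` up to the relative error of `√V̂`. Hence the inflation factor `1 + η`
absorbs both the error of `V̂` and the linearization error
(`exists_tailQuantile_add_le_halfWidth`).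

The worst-case bias `B̂` need not be a measurable function of the first fold. It enters only
through pointwise lower bounds, and the exceptional event of `noiseEvent` is expressed by the bias
at the true `G`, which is measurable (`le_prob_twoFoldLaw`).
-/

namespace MCEB

/-! ### Gaussian tails and the bias-aware half-width -/

/-- The tail probability `P(|b + s Z| > t)` of a normal variable with mean `b` and standard
deviation `s`. -/
noncomputable def absTail (b s t : ℝ) : ℝ≥0∞ :=
  gaussianReal 0 1 {z : ℝ | t < |b + s * z|}

/-- The upper `α`-quantile of `|b + s Z|`, for `Z` standard normal. -/
noncomputable def tailQuantile (α b s : ℝ) : ℝ :=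
  sInf {t : ℝ | absTail b s t ≤ ENNReal.ofReal α}

theorem absTail_antitone (b s : ℝ) : Antitone (absTail b s) := fun _ _ h =>
  measure_mono fun _ hz => lt_of_le_of_lt h hz

theorem measurableSet_absTail (b s t : ℝ) : MeasurableSet {z : ℝ | t < |b + s * z|} :=
  measurableSet_lt measurable_const (by fun_prop)

theorem absTail_of_neg {b s t : ℝ} (ht : t < 0) : absTail b s t = 1 := by
  have : {z : ℝ | t < |b + s * z|} = Set.univ :=
    Set.eq_univ_of_forall fun z => lt_of_lt_of_le ht (abs_nonneg _)
  rw [absTail, this, measure_univ]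

theorem tendsto_absTail_atTop (b s : ℝ) : Tendsto (absTail b s) atTop (𝓝 0) := by
  have h := tendsto_measure_iInter_atTop (μ := gaussianReal 0 1)
    (s := fun t : ℝ => {z : ℝ | t < |b + s * z|})
    (fun t => (measurableSet_absTail b s t).nullMeasurableSet)
    (fun t u htu z (hz : u < _) => lt_of_le_of_lt htu hz)
    ⟨0, measure_ne_top _ _⟩
  have h0 : (⋂ t : ℝ, {z : ℝ | t < |b + s * z|}) = ∅ := by
    ext z
    simp only [Set.mem_iInter, Set.mem_ofPred_eq, Set.mem_empty_iff_false, iff_false, not_forall,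
      not_lt]
    exact ⟨_, le_rfl⟩
  rw [h0, measure_empty] at h
  exact h

theorem tendsto_absTail_add_one_div (b s t : ℝ) :
    Tendsto (fun n : ℕ => absTail b s (t + 1 / ((n : ℝ) + 1))) atTop (𝓝 (absTail b s t)) := by
  have h := tendsto_measure_iUnion_atTop (μ := gaussianReal 0 1)
    (s := fun n : ℕ => {z : ℝ | t + 1 / ((n : ℝ) + 1) < |b + s * z|})
    (by
      intro m n hmn z hz
      simp only [Set.mem_ofPred_eq] at hz ⊢
      have := one_div_le_one_div_of_le (a := (m : ℝ) + 1) (b := (n : ℝ) + 1)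
        (by positivity) (by exact_mod_cast Nat.succ_le_succ hmn)
      linarith)
  have h0 : (⋃ n : ℕ, {z : ℝ | t + 1 / ((n : ℝ) + 1) < |b + s * z|})
      = {z : ℝ | t < |b + s * z|} := by
    ext z
    simp only [Set.mem_iUnion, Set.mem_ofPred_eq]
    constructor
    · rintro ⟨n, hn⟩
      have : (0 : ℝ) < 1 / ((n : ℝ) + 1) := by positivity
      linarith
    · intro hz
      obtain ⟨n, hn⟩ := exists_nat_one_div_lt (sub_pos.2 hz)
      exact ⟨n, by linarith⟩
  rw [h0] at h
  exact h

section Quantile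

variable {α : ℝ}

theorem bddBelow_tailQuantile (hα1 : α < 1) (b s : ℝ) :
    BddBelow {t : ℝ | absTail b s t ≤ ENNReal.ofReal α} := by
  refine ⟨0, fun t ht => ?_⟩
  by_contra hlt
  rw [Set.mem_ofPred_eq, absTail_of_neg (not_le.1 hlt)] at ht
  have : ENNReal.ofReal α < 1 := by
    rw [← ENNReal.ofReal_one]; exact (ENNReal.ofReal_lt_ofReal_iff one_pos).2 hα1
  exact absurd ht (not_le.2 this)

theorem exists_absTail_lt (hα : 0 < α) (b s : ℝ) : ∃ t : ℝ, absTail b s t < ENNReal.ofReal α :=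
  ((tendsto_absTail_atTop b s).eventually_lt_const (ENNReal.ofReal_pos.2 hα)).exists

/-- The quantile is attained, because `t ↦ P(|b + s Z| > t)` is right continuous. -/
theorem absTail_tailQuantile_le (hα : 0 < α) (b s : ℝ) :
    absTail b s (tailQuantile α b s) ≤ ENNReal.ofReal α := by
  refine le_of_tendsto (tendsto_absTail_add_one_div b s _) (Eventually.of_forall fun n => ?_)
  obtain ⟨t, ht⟩ := exists_absTail_lt hα b s
  obtain ⟨u, hu, hlt⟩ := exists_lt_of_csInf_lt (s := {t : ℝ | absTail b s t ≤ ENNReal.ofReal α})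
    ⟨t, ht.le⟩ (lt_add_of_pos_right (tailQuantile α b s)
      (by positivity : (0 : ℝ) < 1 / ((n : ℝ) + 1)))
  exact (absTail_antitone b s hlt.le).trans hu

theorem tailQuantile_le_iff (hα : 0 < α) (hα1 : α < 1) {b s t : ℝ} :
    tailQuantile α b s ≤ t ↔ absTail b s t ≤ ENNReal.ofReal α :=
  ⟨fun h => (absTail_antitone b s h).trans (absTail_tailQuantile_le hα b s),
    fun h => csInf_le (bddBelow_tailQuantile hα1 b s) h⟩

theorem measurable_tailQuantile (hα : 0 < α) (hα1 : α < 1) :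
    Measurable fun p : ℝ × ℝ => tailQuantile α p.1 p.2 := by
  refine measurable_of_Iic fun t => ?_
  have : (fun p : ℝ × ℝ => tailQuantile α p.1 p.2) ⁻¹' Set.Iic t
      = {p : ℝ × ℝ | absTail p.1 p.2 t ≤ ENNReal.ofReal α} := by
    ext p
    exact tailQuantile_le_iff hα hα1
  rw [this]
  refine measurableSet_le ?_ measurable_const
  have hS : MeasurableSet {q : (ℝ × ℝ) × ℝ | t < |q.1.1 + q.1.2 * q.2|} :=
    measurableSet_lt measurable_const (by fun_prop)
  exact measurable_measure_prodMk_left (ν := gaussianReal 0 1) hS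

theorem measurable_tailQuantile_comp (hα : 0 < α) (hα1 : α < 1) {Ω : Type*} [MeasurableSpace Ω]
    {f g : Ω → ℝ} (hf : Measurable f) (hg : Measurable g) :
    Measurable fun ω => tailQuantile α (f ω) (g ω) := by
  have h := (measurable_tailQuantile hα hα1).comp (hf.prodMk hg)
  exact h

end Quantile

section HalfWidth

variable {α : ℝ}

theorem halfWidth_eq_sInf (α B V : ℝ) :
    halfWidth α B V
      = sInf {t : ℝ | ∀ b : ℝ, |b| ≤ B → absTail b (√V) t < ENNReal.ofReal α} := rfl

theorem absTail_le_absTail_zero {b s B t : ℝ} (hb : |b| ≤ B) :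
    absTail b s (B + t) ≤ absTail 0 s t := by
  refine measure_mono fun z (hz : B + t < |b + s * z|) => ?_
  have := abs_add_le b (s * z)
  simp only [Set.mem_ofPred_eq, zero_add]
  linarith

theorem nonempty_halfWidth (hα : 0 < α) (B V : ℝ) :
    {t : ℝ | ∀ b : ℝ, |b| ≤ B → absTail b (√V) t < ENNReal.ofReal α}.Nonempty := by
  obtain ⟨t, ht⟩ := exists_absTail_lt hα 0 (√V)
  exact ⟨B + t, fun b hb => (absTail_le_absTail_zero hb).trans_lt ht⟩

theorem le_halfWidth (hα : 0 < α) {B V r : ℝ}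
    (h : ∀ t : ℝ, (∀ b : ℝ, |b| ≤ B → absTail b (√V) t < ENNReal.ofReal α) → r ≤ t) :
    r ≤ halfWidth α B V := by
  rw [halfWidth_eq_sInf]
  exact le_csInf (nonempty_halfWidth hα B V) h

/-- There is a level that `|Z|` exceeds with probability at least `α`. -/
theorem exists_pos_le_absTail (hα1 : α < 1) :
    ∃ z : ℝ, 0 < z ∧ ENNReal.ofReal α ≤ absTail 0 1 z := by
  have h1 : absTail 0 1 0 = 1 := by
    have : {z : ℝ | 0 < |0 + 1 * z|} = {0}ᶜ := by ext z; simp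
    rw [absTail, this]
    have : NullSingletonClass (gaussianReal 0 1) := nullSingletonClass_gaussianReal (by simp)
    rw [prob_compl_eq_one_iff (measurableSet_singleton _)]
    exact measure_singleton 0
  have h2 : ENNReal.ofReal α < absTail 0 1 0 := by
    rw [h1, ← ENNReal.ofReal_one]; exact (ENNReal.ofReal_lt_ofReal_iff one_pos).2 hα1
  obtain ⟨n, hn⟩ := ((tendsto_absTail_add_one_div 0 1 0).eventually_const_lt h2).exists
  exact ⟨0 + 1 / ((n : ℝ) + 1), by positivity, hn.le⟩

/-- There is a level that `|Z|` stays below with probability at least `α`. -/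
theorem exists_le_absTail_compl (hα1 : α < 1) :
    ∃ z : ℝ, 0 < z ∧ ENNReal.ofReal α ≤ gaussianReal 0 1 {y : ℝ | |y| ≤ z} := by
  have h1 : Tendsto (fun t => 1 - absTail 0 1 t) atTop (𝓝 (1 - 0)) :=
    ENNReal.Tendsto.sub tendsto_const_nhds (tendsto_absTail_atTop 0 1) (Or.inl ENNReal.one_ne_top)
  rw [tsub_zero] at h1
  have h2 : ENNReal.ofReal α < 1 := by
    rw [← ENNReal.ofReal_one]; exact (ENNReal.ofReal_lt_ofReal_iff one_pos).2 hα1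
  obtain ⟨z, hz, hz0⟩ := ((h1.eventually_const_lt h2).and (eventually_gt_atTop 0)).exists
  refine ⟨z, hz0, hz.le.trans ?_⟩
  rw [absTail, ← prob_compl_eq_one_sub (measurableSet_absTail 0 1 z)]
  refine measure_mono fun y hy => ?_
  simpa using hy

/-- The half-width is at least of the order of the sum of the worst-case bias and the standard
deviation. -/
theorem exists_mul_le_halfWidth (hα : 0 < α) (hα1 : α < 1) :
    ∃ c : ℝ, 0 < c ∧ ∀ B V : ℝ, 0 ≤ B → c * (B + √V) ≤ halfWidth α B V := by
  obtain ⟨z₁, hz₁, h₁⟩ := exists_pos_le_absTail hα1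
  obtain ⟨z₂, hz₂, h₂⟩ := exists_le_absTail_compl hα1
  refine ⟨(1 + (z₂ + 1) / z₁)⁻¹, by positivity, fun B V hB => le_halfWidth hα fun t ht => ?_⟩
  have hs : 0 ≤ √V := Real.sqrt_nonneg V
  -- Testing at `b = 0` bounds the standard deviation by `t`.
  have hA : z₁ * √V ≤ t := by
    by_contra hlt
    rw [not_le] at hlt
    refine absurd (ht 0 (by simpa using hB)) (not_lt.2 ?_)
    refine h₁.trans (measure_mono fun z hz => ?_)
    simp only [Set.mem_ofPred_eq, zero_add, one_mul, abs_mul, abs_of_nonneg hs] at hz ⊢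
    nlinarith
  -- Testing at `b = B` bounds the bias by `t` plus a multiple of the standard deviation.
  have hC : B - z₂ * √V ≤ t := by
    by_contra hlt
    rw [not_le] at hlt
    refine absurd (ht B (by rw [abs_of_nonneg hB])) (not_lt.2 ?_)
    refine h₂.trans (measure_mono fun z hz => ?_)
    simp only [Set.mem_ofPred_eq] at hz ⊢
    have := (abs_le.1 hz).1
    refine lt_of_lt_of_le ?_ (le_abs_self _)
    nlinarith
  have hV : √V ≤ t / z₁ := by rw [le_div_iff₀ hz₁]; linarith
  rw [inv_mul_le_iff₀ (by positivity)]
  have : (1 + (z₂ + 1) / z₁) * t = t + (z₂ + 1) * (t / z₁) := by field_simp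
  rw [this]
  nlinarith

/-- The quantile of `|b + s Z|` is controlled by the half-width computed from a different standard
deviation `√V = k s`: this is the comparison `|b + s z| ≤ (|b + k s z| + |k - 1| |b|) / k`. -/
theorem mul_tailQuantile_le (hα : 0 < α) (hα1 : α < 1) {b B s V k : ℝ} (hb : |b| ≤ B)
    (hk : 0 < k) (hV : √V = k * s) :
    k * tailQuantile α b s ≤ halfWidth α B V + |k - 1| * |b| := by
  rw [← sub_le_iff_le_add]
  refine le_halfWidth hα fun t ht => ?_
  have h : tailQuantile α b s ≤ (t + |k - 1| * |b|) / k := by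
    rw [tailQuantile_le_iff hα hα1]
    refine le_trans (measure_mono ?_) (ht b hb).le
    intro z hz
    rw [Set.mem_ofPred_eq, div_lt_iff₀ hk] at hz
    have h1 : |b + s * z| * k = |(b + √V * z) + (k - 1) * b| := by
      rw [hV, ← abs_of_pos hk, ← abs_mul, abs_of_pos hk]
      congr 1; ring
    have h2 := abs_add_le (b + √V * z) ((k - 1) * b)
    rw [abs_mul (k - 1)] at h2
    rw [Set.mem_ofPred_eq]
    linarith
  rw [le_div_iff₀ hk] at h
  linarith

/-- The inflated half-width, computed from a consistent estimate `V` of the variance `s²`,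
dominates the exact quantile at the true bias plus an error of smaller order. -/
theorem exists_tailQuantile_add_le_halfWidth (hα : 0 < α) (hα1 : α < 1) {η : ℝ} (hη : 0 < η) :
    ∃ ρ : ℝ, 0 < ρ ∧ ∀ b B s V e : ℝ, |b| ≤ B → 0 ≤ s → |√V - s| ≤ ρ * s →
      |e| ≤ ρ * (B + s) → tailQuantile α b s + |e| ≤ (1 + η) * halfWidth α B V := by
  obtain ⟨c, hc, hcH⟩ := exists_mul_le_halfWidth hα hα1
  refine ⟨η / (2 / c + (1 + η) + η), by positivity, fun b B s V e hb hs hVs he => ?_⟩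
  set ρ := η / (2 / c + (1 + η) + η) with hρ
  have hρ0 : 0 < ρ := by positivity
  have hρ1 : ρ < 1 := by
    rw [hρ, div_lt_one (by positivity)]
    have : 0 < 2 / c := by positivity
    linarith
  have hρη : ρ * (2 / c + (1 + η)) ≤ η := by
    have : ρ * (2 / c + (1 + η) + η) = η := by rw [hρ]; field_simp
    nlinarith
  have hB : 0 ≤ B := (abs_nonneg b).trans hb
  set H := halfWidth α B V with hH
  have hHc := hcH B V hB
  rw [← hH] at hHc
  have hV0 : 0 ≤ √V := Real.sqrt_nonneg V
  have hBH : B + √V ≤ H / c := by rw [le_div_iff₀ hc]; linarith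
  have hH0 : 0 ≤ H := le_trans (by positivity) hHc
  obtain ⟨hl, hu⟩ := abs_le.1 hVs
  -- The ratio `k` of the two standard deviations is within `ρ` of one.
  obtain ⟨k, hk0, hk1, hkV⟩ : ∃ k : ℝ, 1 - ρ ≤ k ∧ |k - 1| ≤ ρ ∧ √V = k * s := by
    rcases hs.eq_or_lt with h0 | h0
    · exact ⟨1, by linarith, by simpa using hρ0.le, by rw [← h0] at hl hu ⊢; linarith⟩
    · refine ⟨√V / s, ?_, ?_, by field_simp⟩
      · rw [le_div_iff₀ h0]; linarith
      · rw [div_sub_one h0.ne', abs_div, abs_of_pos h0, div_le_iff₀ h0]; exact hVs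
  have hkpos : 0 < k := by linarith
  have hq := mul_tailQuantile_le hα hα1 hb hkpos hkV
  rw [← hH] at hq
  have hbH : |b| ≤ H / c := by linarith
  have hks : (1 - ρ) * (B + s) ≤ H / c := by nlinarith
  have h1 : |k - 1| * |b| ≤ ρ * (H / c) := by gcongr
  have h2 : k * tailQuantile α b s ≤ H + ρ * (H / c) := by linarith
  have h3 : k * |e| ≤ k * ρ * (B + s) := by nlinarith
  have h4 : (1 - ρ) * |e| ≤ ρ * (H / c) := by nlinarith
  rcases le_total 0 (tailQuantile α b s) with hq0 | hq0
  · have h5 : (1 - ρ) * (tailQuantile α b s + |e|) ≤ H + ρ * (2 / c) * H := by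
      have : ρ * (2 / c) * H = ρ * (H / c) + ρ * (H / c) := by ring
      nlinarith
    have h6 : H + ρ * (2 / c) * H ≤ (1 - ρ) * ((1 + η) * H) := by nlinarith
    exact le_of_mul_le_mul_left (h5.trans h6) (by linarith)
  · have h5 : (1 - ρ) * (tailQuantile α b s + |e|) ≤ H + ρ * (2 / c) * H := by
      have h7 : 0 ≤ ρ * (H / c) := by positivity
      have : ρ * (2 / c) * H = ρ * (H / c) + ρ * (H / c) := by ring
      nlinarith
    have h6 : H + ρ * (2 / c) * H ≤ (1 - ρ) * ((1 + η) * H) := by nlinarith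
    exact le_of_mul_le_mul_left (h5.trans h6) (by linarith)

end HalfWidth

/-! ### A uniform central limit theorem for bounded triangular arrays -/

theorem norm_pow_sub_pow_le {a b : ℂ} (ha : ‖a‖ ≤ 1) (hb : ‖b‖ ≤ 1) (n : ℕ) :
    ‖a ^ n - b ^ n‖ ≤ n * ‖a - b‖ := by
  induction n with
  | zero => simp
  | succ n ih =>
    have h : a ^ (n + 1) - b ^ (n + 1) = a * (a ^ n - b ^ n) + (a - b) * b ^ n := by ring
    rw [h]
    have hbn : ‖b ^ n‖ ≤ 1 := by rw [norm_pow]; exact pow_le_one₀ (norm_nonneg _) hb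
    calc ‖a * (a ^ n - b ^ n) + (a - b) * b ^ n‖
        ≤ ‖a‖ * ‖a ^ n - b ^ n‖ + ‖a - b‖ * ‖b ^ n‖ := by
          rw [← norm_mul, ← norm_mul]; exact norm_add_le _ _
      _ ≤ 1 * (n * ‖a - b‖) + ‖a - b‖ * 1 := by gcongr
      _ = ((n + 1 : ℕ) : ℝ) * ‖a - b‖ := by push_cast; ring

theorem norm_cexp_mul_I_sub_le {y : ℝ} (hy : |y| ≤ 1) :
    ‖Complex.exp (y * Complex.I) - (1 + y * Complex.I - y ^ 2 / 2)‖ ≤ |y| ^ 3 := by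
  have hx : ‖(y * Complex.I : ℂ)‖ = |y| := by simp
  have h := Complex.exp_bound (x := y * Complex.I) (by rw [hx]; exact hy) (n := 3) (by norm_num)
  rw [hx] at h
  have hs : ∑ m ∈ Finset.range 3, (y * Complex.I : ℂ) ^ m / (m.factorial : ℂ)
      = 1 + y * Complex.I - y ^ 2 / 2 := by
    simp only [Finset.sum_range_succ, Finset.sum_range_zero, Nat.factorial]
    push_cast
    ring_nf
    rw [Complex.I_sq]
    ring
  rw [hs] at h
  refine h.trans ?_
  have h3 : (0 : ℝ) ≤ |y| ^ 3 := by positivity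
  have : (((Nat.succ 3 : ℕ) : ℝ) * (((Nat.factorial 3 : ℕ) : ℝ) * ((3 : ℕ) : ℝ))⁻¹) ≤ 1 := by
    norm_num [Nat.factorial]
  nlinarith

section Standardized

variable {Ω : Type*} [MeasurableSpace Ω] {P : Measure Ω} [IsProbabilityMeasure P] {Y : Ω → ℝ}
  {D : ℝ}

theorem integrable_of_abs_le (hY : Measurable Y) (hD : ∀ᵐ ω ∂P, |Y ω| ≤ D) : Integrable Y P :=
  Integrable.of_bound hY.aestronglyMeasurable D hD

theorem integrable_sq_of_abs_le (hY : Measurable Y) (hD : ∀ᵐ ω ∂P, |Y ω| ≤ D) :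
    Integrable (fun ω => Y ω ^ 2) P := by
  refine Integrable.of_bound (hY.pow_const 2).aestronglyMeasurable (D ^ 2) ?_
  filter_upwards [hD] with ω hω
  rw [Real.norm_eq_abs, abs_pow]
  gcongr

theorem one_le_of_abs_le (hY : Measurable Y) (hD : ∀ᵐ ω ∂P, |Y ω| ≤ D)
    (h2 : ∫ ω, Y ω ^ 2 ∂P = 1) : 1 ≤ D := by
  have hD0 : 0 ≤ D := by
    obtain ⟨ω, hω⟩ := hD.exists
    exact (abs_nonneg _).trans hω
  have h : ∫ ω, Y ω ^ 2 ∂P ≤ ∫ _, D ^ 2 ∂P := by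
    refine integral_mono_ae (integrable_sq_of_abs_le hY hD) (integrable_const _) ?_
    filter_upwards [hD] with ω hω
    rw [← sq_abs]
    gcongr
  rw [h2, integral_const, probReal_univ, one_smul] at h
  nlinarith

/-- Third-order Taylor bound for the characteristic function of a bounded standardized variable,
compared with the Gaussian one. -/
theorem norm_charFun_sub_exp_le (hY : Measurable Y) (hD : ∀ᵐ ω ∂P, |Y ω| ≤ D)
    (h1 : ∫ ω, Y ω ∂P = 0) (h2 : ∫ ω, Y ω ^ 2 ∂P = 1) {u : ℝ} (hu : |u| * D ≤ 1) :
    ‖(∫ ω, Complex.exp ((u * Y ω : ℝ) * Complex.I) ∂P) - Complex.exp (-(u ^ 2 / 2 : ℝ))‖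
      ≤ 2 * |u| ^ 3 * D := by
  have hD1 := one_le_of_abs_le hY hD h2
  have hu0 := abs_nonneg u
  have hu1 : |u| ≤ 1 := by nlinarith
  have hi1 := integrable_of_abs_le hY hD
  have hi2 := integrable_sq_of_abs_le hY hD
  have hexp : Integrable (fun ω => Complex.exp ((u * Y ω : ℝ) * Complex.I)) P := by
    refine Integrable.of_bound (by fun_prop) 1 (Eventually.of_forall fun ω => ?_)
    rw [Complex.norm_exp_ofReal_mul_I]
  have hquad : Integrable (fun ω => (1 + (u * Y ω : ℝ) * Complex.I
      - ((u * Y ω : ℝ) : ℂ) ^ 2 / 2 : ℂ)) P := by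
    refine ((integrable_const _).add (((hi1.const_mul u).ofReal).mul_const _)).sub ?_
    refine Integrable.div_const ?_ 2
    refine ((hi2.const_mul (u ^ 2)).ofReal (𝕜 := ℂ)).congr (Eventually.of_forall fun ω => ?_)
    change ((u ^ 2 * Y ω ^ 2 : ℝ) : ℂ) = ((u * Y ω : ℝ) : ℂ) ^ 2
    push_cast
    ring
  have hq : ∫ ω, (1 + (u * Y ω : ℝ) * Complex.I - ((u * Y ω : ℝ) : ℂ) ^ 2 / 2 : ℂ) ∂P
      = 1 - u ^ 2 / 2 := by
    have e1 : ∀ ω, (1 + (u * Y ω : ℝ) * Complex.I - ((u * Y ω : ℝ) : ℂ) ^ 2 / 2 : ℂ)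
        = ((1 - u ^ 2 / 2 * Y ω ^ 2 : ℝ) : ℂ) + ((u * Y ω : ℝ) : ℂ) * Complex.I := by
      intro ω; push_cast; ring
    simp_rw [e1]
    rw [integral_add, integral_mul_const, integral_complex_ofReal,
      integral_complex_ofReal, integral_sub,
      integral_const_mul, integral_const_mul, h1, h2]
    · simp
    · exact integrable_const _
    · exact hi2.const_mul _
    · exact ((integrable_const _).sub (hi2.const_mul _)).ofReal
    · exact (hi1.const_mul u).ofReal.mul_const _
  have hA : ‖(∫ ω, Complex.exp ((u * Y ω : ℝ) * Complex.I) ∂P) - (1 - u ^ 2 / 2)‖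
      ≤ |u| ^ 3 * D := by
    rw [← hq, ← integral_sub hexp hquad]
    refine (norm_integral_le_of_norm_le (g := fun ω => |u| ^ 3 * D * Y ω ^ 2)
      (hi2.const_mul _) ?_).trans (by rw [integral_const_mul, h2, mul_one])
    filter_upwards [hD] with ω hω
    have hy : |u * Y ω| ≤ 1 := by
      rw [abs_mul]
      exact (mul_le_mul_of_nonneg_left hω hu0).trans hu
    refine (norm_cexp_mul_I_sub_le hy).trans ?_
    rw [abs_mul, mul_pow]
    have : |Y ω| ^ 3 ≤ D * Y ω ^ 2 := by
      rw [pow_succ, sq_abs, mul_comm]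
      gcongr
    calc |u| ^ 3 * |Y ω| ^ 3 ≤ |u| ^ 3 * (D * Y ω ^ 2) := by gcongr
      _ = |u| ^ 3 * D * Y ω ^ 2 := by ring
  have hB : ‖(1 - u ^ 2 / 2 : ℂ) - Complex.exp (-(u ^ 2 / 2 : ℝ))‖ ≤ |u| ^ 3 * D := by
    have hx : |-(u ^ 2 / 2)| ≤ 1 := by
      rw [abs_neg, abs_of_nonneg (by positivity), ← sq_abs]
      nlinarith
    have h := Real.abs_exp_sub_one_sub_id_le hx
    have h' : ‖(1 - u ^ 2 / 2 : ℂ) - Complex.exp (-(u ^ 2 / 2 : ℝ))‖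
        = |Real.exp (-(u ^ 2 / 2)) - 1 - -(u ^ 2 / 2)| := by
      rw [norm_sub_rev, ← Real.norm_eq_abs, ← Complex.norm_real]
      congr 1
      push_cast
      ring
    rw [h']
    refine h.trans ?_
    have : (-(u ^ 2 / 2)) ^ 2 = |u| ^ 3 * |u| / 4 := by
      have : |u| ^ 3 * |u| = (|u| ^ 2) ^ 2 := by ring
      rw [this, sq_abs]; ring
    rw [this]
    have h3 : 0 ≤ |u| ^ 3 := by positivity
    nlinarith
  calc _ ≤ ‖(∫ ω, Complex.exp ((u * Y ω : ℝ) * Complex.I) ∂P) - (1 - u ^ 2 / 2)‖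
        + ‖(1 - u ^ 2 / 2 : ℂ) - Complex.exp (-(u ^ 2 / 2 : ℝ))‖ :=
        norm_sub_le_norm_sub_add_norm_sub _ _ _
    _ ≤ _ := by linarith

theorem charFun_map_sum_pi (hY : Measurable Y) (m : ℕ) (t : ℝ) :
    charFun ((Measure.pi fun _ : Fin m => P).map fun X => (√(m : ℝ))⁻¹ * ∑ i, Y (X i)) t
      = (∫ ω, Complex.exp (((√(m : ℝ))⁻¹ * t * Y ω : ℝ) * Complex.I) ∂P) ^ m := by
  have hmeas : Measurable fun X : Fin m → Ω => (√(m : ℝ))⁻¹ * ∑ i, Y (X i) := by fun_prop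
  rw [charFun_apply_real, integral_map hmeas.aemeasurable (by fun_prop)]
  have h := integral_fintype_prod_eq_pow (ι := Fin m) (μ := P)
    (f := fun ω => Complex.exp (((√(m : ℝ))⁻¹ * t * Y ω : ℝ) * Complex.I))
  rw [Fintype.card_fin] at h
  rw [← h]
  refine integral_congr_ae (Eventually.of_forall fun X => ?_)
  simp only
  rw [← Complex.exp_sum]
  congr 1
  push_cast
  rw [Finset.mul_sum, Finset.mul_sum, Finset.sum_mul]
  refine Finset.sum_congr rfl fun i _ => ?_
  ring

theorem norm_charFun_sum_sub_le (hY : Measurable Y) (hD : ∀ᵐ ω ∂P, |Y ω| ≤ D)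
    (h1 : ∫ ω, Y ω ∂P = 0) (h2 : ∫ ω, Y ω ^ 2 ∂P = 1) {m : ℕ} {τ t : ℝ}
    (hm : D ≤ τ * √(m : ℝ)) (ht : |t| * τ ≤ 1) :
    ‖charFun ((Measure.pi fun _ : Fin m => P).map fun X => (√(m : ℝ))⁻¹ * ∑ i, Y (X i)) t
      - charFun (gaussianReal 0 1) t‖ ≤ 2 * |t| ^ 3 * τ := by
  have hD1 := one_le_of_abs_le hY hD h2
  have hs : 0 < √(m : ℝ) := by
    rcases (Real.sqrt_nonneg (m : ℝ)).eq_or_lt with h | h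
    · rw [← h, mul_zero] at hm; linarith
    · exact h
  have hs2 : √(m : ℝ) ^ 2 = m := Real.sq_sqrt (Nat.cast_nonneg m)
  set s := √(m : ℝ) with hsdef
  have hu : |s⁻¹ * t| * D ≤ 1 := by
    rw [abs_mul, abs_of_pos (inv_pos.2 hs)]
    calc s⁻¹ * |t| * D ≤ s⁻¹ * |t| * (τ * s) := by gcongr
      _ = |t| * τ := by field_simp
      _ ≤ 1 := ht
  have hb := norm_charFun_sub_exp_le hY hD h1 h2 hu
  have hg : charFun (gaussianReal 0 1) t
      = Complex.exp (-((s⁻¹ * t) ^ 2 / 2 : ℝ)) ^ m := by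
    rw [charFun_gaussianReal, ← Complex.exp_nat_mul]
    congr 1
    have hm0 : (m : ℂ) ≠ 0 := by
      intro h0
      have : (m : ℝ) = 0 := by exact_mod_cast h0
      rw [this] at hs2
      exact hs.ne' (pow_eq_zero_iff two_ne_zero |>.1 hs2)
    have : ((s : ℂ)) ^ 2 = m := by exact_mod_cast hs2
    have hsc : (s : ℂ) ≠ 0 := by exact_mod_cast hs.ne'
    push_cast
    rw [mul_pow, inv_pow, this]
    field_simp
    simp only [zero_mul, zero_sub]
    ring
  rw [charFun_map_sum_pi hY, ← hsdef, hg]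
  refine (norm_pow_sub_pow_le ?_ ?_ m).trans ?_
  · refine (norm_integral_le_of_norm_le_const (C := 1) (Eventually.of_forall fun ω => ?_)).trans ?_
    · rw [Complex.norm_exp_ofReal_mul_I]
    · simp
  · rw [← Complex.ofReal_neg, Complex.norm_exp_ofReal]
    exact Real.exp_le_one_iff.2 (by
      have : 0 ≤ (s⁻¹ * t) ^ 2 / 2 := by positivity
      linarith)
  · calc (m : ℝ) * _ ≤ m * (2 * |s⁻¹ * t| ^ 3 * D) := by gcongr
      _ ≤ m * (2 * |s⁻¹ * t| ^ 3 * (τ * s)) := by gcongr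
      _ = 2 * |t| ^ 3 * τ := by
        rw [abs_mul, abs_of_pos (inv_pos.2 hs), ← hs2]
        field_simp

end Standardized

theorem gaussianPDFReal_std_le_one (u : ℝ) : gaussianPDFReal 0 1 u ≤ 1 := by
  rw [gaussianPDFReal_def]
  have h1 : Real.exp (-(u - 0) ^ 2 / (2 * ((1 : ℝ≥0) : ℝ))) ≤ 1 := by
    refine Real.exp_le_one_iff.2 (div_nonpos_of_nonpos_of_nonneg ?_ (by positivity))
    linarith [sq_nonneg (u - 0)]
  have h2 : (√(2 * Real.pi * ((1 : ℝ≥0) : ℝ)))⁻¹ ≤ 1 := by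
    refine inv_le_one_of_one_le₀ ?_
    rw [Real.one_le_sqrt]
    have := Real.pi_gt_three
    push_cast
    linarith
  exact mul_le_one₀ h2 (Real.exp_pos _).le h1

theorem gaussianReal_Icc_le (a b : ℝ) :
    gaussianReal 0 1 (Set.Icc a b) ≤ ENNReal.ofReal (b - a) := by
  rw [gaussianReal_apply 0 (by simp)]
  calc ∫⁻ x in Set.Icc a b, gaussianPDF 0 1 x ≤ ∫⁻ _ in Set.Icc a b, 1 := by
        refine lintegral_mono fun x => ?_
        rw [gaussianPDF, ← ENNReal.ofReal_one]
        refine ENNReal.ofReal_le_ofReal ?_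
        exact gaussianPDFReal_std_le_one x
    _ = ENNReal.ofReal (b - a) := by simp

/-- Weak convergence to the standard normal law is uniform over compact intervals: shrinking an
interval by the Lévy-Prokhorov distance costs little Gaussian mass. -/
theorem eventually_forall_gaussianReal_Icc_le {μ : ℕ → ProbabilityMeasure ℝ}
    {ν : ProbabilityMeasure ℝ} (hν : (ν : Measure ℝ) = gaussianReal 0 1)
    (hμ : Tendsto μ atTop (𝓝 ν)) {ε : ℝ} (hε : 0 < ε) :
    ∀ᶠ k in atTop, ∀ a b : ℝ,
      gaussianReal 0 1 (Set.Icc a b) ≤ (μ k : Measure ℝ) (Set.Icc a b) + ENNReal.ofReal ε := by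
  have h := (LevyProkhorov.continuous_ofMeasure_probabilityMeasure
    (Ω := ℝ)).continuousAt.tendsto.comp hμ
  have h3 : 0 < ε / 3 := by positivity
  have h' := (EMetric.tendsto_nhds.1 h) (ENNReal.ofReal (ε / 3)) (ENNReal.ofReal_pos.2 h3)
  filter_upwards [h'] with k hk a b
  rw [Function.comp_apply, LevyProkhorov.edist_probabilityMeasure_def] at hk
  have hlp := right_measure_le_of_levyProkhorovEDist_lt hk
    (measurableSet_Icc (a := a + ε / 3) (b := b - ε / 3))
  rw [ENNReal.toReal_ofReal h3.le] at hlp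
  change (ν : Measure ℝ) _ ≤ (μ k : Measure ℝ) _ + _ at hlp
  rw [hν] at hlp
  have hthick : Metric.thickening (ε / 3) (Set.Icc (a + ε / 3) (b - ε / 3)) ⊆ Set.Icc a b := by
    intro x hx
    obtain ⟨y, hy, hxy⟩ := Metric.mem_thickening_iff.1 hx
    rw [Real.dist_eq] at hxy
    obtain ⟨h1, h2⟩ := abs_lt.1 hxy
    exact ⟨by linarith [hy.1], by linarith [hy.2]⟩
  have hcover : Set.Icc a b ⊆ Set.Icc (a + ε / 3) (b - ε / 3)
      ∪ (Set.Icc a (a + ε / 3) ∪ Set.Icc (b - ε / 3) b) := by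
    intro x hx
    by_cases h1 : x ≤ a + ε / 3
    · exact Or.inr (Or.inl ⟨hx.1, h1⟩)
    by_cases h2 : b - ε / 3 ≤ x
    · exact Or.inr (Or.inr ⟨h2, hx.2⟩)
    · exact Or.inl ⟨by linarith, by linarith⟩
  calc gaussianReal 0 1 (Set.Icc a b)
      ≤ gaussianReal 0 1 (Set.Icc (a + ε / 3) (b - ε / 3))
        + (gaussianReal 0 1 (Set.Icc a (a + ε / 3))
          + gaussianReal 0 1 (Set.Icc (b - ε / 3) b)) := by
        refine (measure_mono hcover).trans ((measure_union_le _ _).trans ?_)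
        gcongr
        exact measure_union_le _ _
    _ ≤ ((μ k : Measure ℝ) (Set.Icc a b) + ENNReal.ofReal (ε / 3))
        + (ENNReal.ofReal (ε / 3) + ENNReal.ofReal (ε / 3)) := by
        gcongr
        · exact hlp.trans (by gcongr)
        · refine (gaussianReal_Icc_le _ _).trans (le_of_eq (by congr 1; ring))
        · refine (gaussianReal_Icc_le _ _).trans (le_of_eq (by congr 1; ring))
    _ = (μ k : Measure ℝ) (Set.Icc a b) + ENNReal.ofReal ε := by
        rw [add_assoc, ← ENNReal.ofReal_add h3.le h3.le, ← ENNReal.ofReal_add h3.le (by positivity)]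
        congr 2
        ring

/-- Central limit theorem, uniformly over all standardized summands bounded by `τ √m`. -/
theorem exists_gaussianReal_Icc_le {Ω : Type*} [MeasurableSpace Ω] (P : Measure Ω)
    [IsProbabilityMeasure P] {ε : ℝ} (hε : 0 < ε) :
    ∃ τ : ℝ, 0 < τ ∧ ∀ (m : ℕ) (Y : Ω → ℝ), Measurable Y → (∀ᵐ ω ∂P, |Y ω| ≤ τ * √(m : ℝ)) →
      ∫ ω, Y ω ∂P = 0 → ∫ ω, Y ω ^ 2 ∂P = 1 → ∀ a b : ℝ,
      gaussianReal 0 1 (Set.Icc a b)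
        ≤ (Measure.pi fun _ : Fin m => P)
            {X | (√(m : ℝ))⁻¹ * ∑ i, Y (X i) ∈ Set.Icc a b} + ENNReal.ofReal ε := by
  by_contra hcon
  push Not at hcon
  have hpos : ∀ k : ℕ, (0 : ℝ) < 1 / ((k : ℝ) + 1) := fun k => by positivity
  choose m Y hY hD h1 h2 a b hab using fun k : ℕ => hcon (1 / ((k : ℝ) + 1)) (hpos k)
  have hmeas : ∀ k, Measurable fun X : Fin (m k) → Ω => (√(m k : ℝ))⁻¹ * ∑ i, Y k (X i) := by
    intro k
    have := hY k
    fun_prop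
  let μ : ℕ → ProbabilityMeasure ℝ := fun k =>
    ⟨(Measure.pi fun _ : Fin (m k) => P).map fun X => (√(m k : ℝ))⁻¹ * ∑ i, Y k (X i),
      Measure.isProbabilityMeasure_map (hmeas k).aemeasurable⟩
  let ν : ProbabilityMeasure ℝ := ⟨gaussianReal 0 1, inferInstance⟩
  have hlim : Tendsto μ atTop (𝓝 ν) := by
    refine ProbabilityMeasure.tendsto_iff_tendsto_charFun.2 fun t => ?_
    rw [tendsto_iff_norm_sub_tendsto_zero]
    have hz : Tendsto (fun k : ℕ => 2 * |t| ^ 3 * (1 / ((k : ℝ) + 1))) atTop (𝓝 0) := by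
      have h := (tendsto_one_div_add_atTop_nhds_zero_nat (𝕜 := ℝ)).const_mul (2 * |t| ^ 3)
      rwa [mul_zero] at h
    refine squeeze_zero' (Eventually.of_forall fun k => norm_nonneg _) ?_ hz
    have hsmall : ∀ᶠ k : ℕ in atTop, |t| * (1 / ((k : ℝ) + 1)) ≤ 1 := by
      have : Tendsto (fun k : ℕ => |t| * (1 / ((k : ℝ) + 1))) atTop (𝓝 0) := by
        simpa only [mul_zero] using tendsto_one_div_add_atTop_nhds_zero_nat.const_mul |t|
      exact (this.eventually_lt_const one_pos).mono fun k hk => hk.le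
    filter_upwards [hsmall] with k hk
    exact norm_charFun_sum_sub_le (hY k) (hD k) (h1 k) (h2 k) le_rfl hk
  obtain ⟨k, hk⟩ := (eventually_forall_gaussianReal_Icc_le rfl hlim hε).exists
  refine absurd (hk (a k) (b k)) (not_le.2 ?_)
  have hmap : (μ k : Measure ℝ) (Set.Icc (a k) (b k))
      = (Measure.pi fun _ : Fin (m k) => P)
          {X | (√(m k : ℝ))⁻¹ * ∑ i, Y k (X i) ∈ Set.Icc (a k) (b k)} :=
    Measure.map_apply (hmeas k) measurableSet_Icc
  rw [hmap]
  exact hab k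

/-! ### Sample means and sample variances -/

section SampleMoments

variable {Ω : Type*} [MeasurableSpace Ω] {P : Measure Ω} [IsProbabilityMeasure P]

/-- Chebyshev's inequality for the mean of `m` i.i.d. bounded variables. -/
theorem meas_le_abs_mean_sub_le {g : Ω → ℝ} (hg : Measurable g) {K : ℝ}
    (hK : ∀ᵐ ω ∂P, |g ω| ≤ K) {m : ℕ} (hm : 0 < m) {v c : ℝ} (hv : ∫ ω, g ω ^ 2 ∂P ≤ v)
    (hc : 0 < c) :
    (Measure.pi fun _ : Fin m => P)
      {X | c ≤ |(1 / (m : ℝ)) * ∑ i, g (X i) - ∫ ω, g ω ∂P|} ≤ ENNReal.ofReal (v / (m * c ^ 2)) := by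
  have hm' : (0 : ℝ) < m := by exact_mod_cast hm
  have hL2 : MemLp g 2 P := MemLp.of_bound hg.aestronglyMeasurable K hK
  have hcoord : ∀ i : Fin m, MemLp (fun X : Fin m → Ω => g (X i)) 2 (Measure.pi fun _ => P) :=
    fun i => hL2.comp_measurePreserving (measurePreserving_eval _ i)
  have hsum : MemLp (fun X : Fin m → Ω => ∑ i, g (X i)) 2 (Measure.pi fun _ => P) :=
    memLp_finsetSum _ fun i _ => hcoord i
  have hmean : ∫ X : Fin m → Ω, (1 / (m : ℝ)) * ∑ i, g (X i) ∂(Measure.pi fun _ => P)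
      = ∫ ω, g ω ∂P := by
    rw [integral_const_mul, integral_finsetSum _ fun i _ => (hcoord i).integrable one_le_two]
    have : ∀ i : Fin m, ∫ X : Fin m → Ω, g (X i) ∂(Measure.pi fun _ => P) = ∫ ω, g ω ∂P :=
      fun i => integral_comp_eval hg.aestronglyMeasurable
    simp only [this, Finset.sum_const, Finset.card_univ, Fintype.card_fin, nsmul_eq_mul]
    field_simp
  have hvar : Var[fun X : Fin m → Ω => (1 / (m : ℝ)) * ∑ i, g (X i); Measure.pi fun _ => P]
      ≤ v / m := by
    rw [variance_const_mul]
    have h := variance_sum_pi (μ := fun _ : Fin m => P) (X := fun _ => g) fun _ => hL2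
    have h' : (fun X : Fin m → Ω => ∑ i, g (X i)) = ∑ i, fun X : Fin m → Ω => g (X i) := by
      ext X; simp
    rw [h', h]
    simp only [Finset.sum_const, Finset.card_univ, Fintype.card_fin, nsmul_eq_mul]
    have : Var[g; P] ≤ v := (variance_le_expectation_sq hg.aestronglyMeasurable).trans hv
    calc (1 / (m : ℝ)) ^ 2 * (m * Var[g; P]) = Var[g; P] / m := by field_simp
      _ ≤ v / m := by gcongr
  have h := meas_ge_le_variance_div_sq (hsum.const_mul (1 / (m : ℝ))) hc
  rw [hmean] at h
  refine h.trans (ENNReal.ofReal_le_ofReal ?_)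
  calc _ ≤ (v / m) / c ^ 2 := by gcongr
    _ = v / (m * c ^ 2) := by rw [div_div]

end SampleMoments

theorem abs_sqrt_sub_one_le (W : ℝ) : |√W - 1| ≤ |W - 1| := by
  rcases le_total 0 W with h | h
  · have h1 : W - 1 = (√W - 1) * (√W + 1) := by
      have := Real.sq_sqrt h
      nlinarith
    rw [h1, abs_mul]
    have h2 : 1 ≤ |√W + 1| := by
      rw [abs_of_nonneg (by positivity)]
      linarith [Real.sqrt_nonneg W]
    nlinarith [abs_nonneg (√W - 1)]
  · rw [Real.sqrt_eq_zero_of_nonpos h, abs_of_nonpos (by linarith : W - 1 ≤ 0)]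
    simp only [zero_sub, abs_neg, abs_one]
    linarith

/-- The sample variance in terms of the standardized observations. -/
theorem varianceEstimate_eq {m : ℕ} (hm : 2 ≤ m) {f Y : ℝ → ℝ} {μ s : ℝ}
    (hf : ∀ u, f u = μ + s * Y u) (X : Fin m → ℝ) :
    varianceEstimate f X = s ^ 2 / m * ((m : ℝ) / (m - 1)
      * ((1 / (m : ℝ)) * ∑ i, Y (X i) ^ 2 - ((1 / (m : ℝ)) * ∑ i, Y (X i)) ^ 2)) := by
  have hm' : (2 : ℝ) ≤ m := by exact_mod_cast hm
  have hm1 : (m : ℝ) - 1 ≠ 0 := by linarith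
  have hm0 : (m : ℝ) ≠ 0 := by linarith
  have h1 : ∑ i, f (X i) = m * μ + s * ∑ i, Y (X i) := by
    simp [hf, Finset.sum_add_distrib, Finset.mul_sum]
  have h2 : ∑ i, f (X i) ^ 2
      = m * μ ^ 2 + 2 * μ * s * ∑ i, Y (X i) + s ^ 2 * ∑ i, Y (X i) ^ 2 := by
    have : ∀ i, f (X i) ^ 2 = μ ^ 2 + 2 * μ * s * Y (X i) + s ^ 2 * Y (X i) ^ 2 := fun i => by
      rw [hf]; ring
    simp [this, Finset.sum_add_distrib, Finset.mul_sum]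
  rw [varianceEstimate, h1, h2]
  field_simp
  ring

/-- The relative error of the estimated standard deviation is controlled by the errors of the sample
mean of the squares and of the square of the sample mean of the standardized observations. -/
theorem abs_sqrt_varianceEstimate_sub_le {m : ℕ} (hm : 2 ≤ m) {f Y : ℝ → ℝ} {μ s ρ : ℝ}
    (hs : 0 < s) (hf : ∀ u, f u = μ + s * Y u) {X : Fin m → ℝ} (hmρ : 1 / (m : ℝ) ≤ ρ / 6)
    (h1 : |(1 / (m : ℝ)) * ∑ i, Y (X i) ^ 2 - 1| ≤ ρ / 6)
    (h2 : ((1 / (m : ℝ)) * ∑ i, Y (X i)) ^ 2 ≤ ρ / 6) :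
    |√(varianceEstimate f X) - s / √(m : ℝ)| ≤ ρ * (s / √(m : ℝ)) := by
  have hm' : (2 : ℝ) ≤ m := by exact_mod_cast hm
  have hmpos : (0 : ℝ) < m := by linarith
  have hsm : 0 < √(m : ℝ) := Real.sqrt_pos.2 hmpos
  rw [varianceEstimate_eq hm hf]
  generalize (1 / (m : ℝ)) * ∑ i, Y (X i) ^ 2 = a at h1 ⊢
  generalize (1 / (m : ℝ)) * ∑ i, Y (X i) = q at h2 ⊢
  have hm1 : (0 : ℝ) < m - 1 := by linarith
  have hW1 : |(m : ℝ) / (m - 1) * (a - q ^ 2) - 1| ≤ ρ := by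
    have e : (m : ℝ) / (m - 1) * (a - q ^ 2) - 1
        = (m : ℝ) / (m - 1) * ((a - 1) - q ^ 2) + 1 / (m - 1) := by
      field_simp; ring
    have b1 : (m : ℝ) / (m - 1) ≤ 2 := by rw [div_le_iff₀ hm1]; linarith
    have b2 : 1 / ((m : ℝ) - 1) ≤ 2 * (1 / m) := by
      rw [mul_one_div, div_le_div_iff₀ hm1 hmpos]; linarith
    have b3 : |(a - 1) - q ^ 2| ≤ ρ / 3 := by
      obtain ⟨h3, h4⟩ := abs_le.1 h1
      have := sq_nonneg q
      rw [abs_le]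
      constructor <;> linarith
    rw [e]
    refine (abs_add_le _ _).trans ?_
    rw [abs_mul, abs_of_pos (by positivity : 0 < (m : ℝ) / (m - 1)),
      abs_of_pos (by positivity : 0 < 1 / ((m : ℝ) - 1))]
    have b4 : (m : ℝ) / (m - 1) * |(a - 1) - q ^ 2| ≤ 2 * (ρ / 3) := by gcongr
    linarith
  generalize (m : ℝ) / (m - 1) * (a - q ^ 2) = W at hW1 ⊢
  have hV : √(s ^ 2 / m * W) = s / √(m : ℝ) * √W := by
    rw [Real.sqrt_mul (by positivity), Real.sqrt_div (by positivity), Real.sqrt_sq hs.le]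
  have e3 : s / √(m : ℝ) * √W - s / √(m : ℝ) = s / √(m : ℝ) * (√W - 1) := by ring
  rw [hV, e3, abs_mul, abs_of_pos (by positivity : 0 < s / √(m : ℝ)), mul_comm ρ]
  gcongr
  exact (abs_sqrt_sub_one_le W).trans hW1

section Noise

variable {P : Measure ℝ} [IsProbabilityMeasure P]

/-- The standardization of a bounded weight function. -/
theorem exists_standardization {f : ℝ → ℝ} (hf : Measurable f) {K : ℝ} (hK : ∀ᵐ u ∂P, |f u| ≤ K)
    {s : ℝ} (hs : 0 < s) (hvar : Var[f; P] = s ^ 2) :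
    ∃ Y : ℝ → ℝ, Measurable Y ∧ (∀ u, f u = (∫ v, f v ∂P) + s * Y u)
      ∧ (∀ᵐ u ∂P, |Y u| ≤ 2 * K / s) ∧ ∫ u, Y u ∂P = 0 ∧ ∫ u, Y u ^ 2 ∂P = 1 := by
  have hi := integrable_of_abs_le hf hK
  refine ⟨fun u => (f u - ∫ v, f v ∂P) / s, by fun_prop, fun u => by field_simp; ring, ?_, ?_, ?_⟩
  · have hμ : |∫ v, f v ∂P| ≤ K := by
      have h := norm_integral_le_of_norm_le_const (μ := P) (f := f) (C := K) hK
      simpa using h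
    filter_upwards [hK] with u hu
    rw [abs_div, abs_of_pos hs]
    have := abs_sub (f u) (∫ v, f v ∂P)
    gcongr
    linarith
  · rw [integral_div, integral_sub hi (integrable_const _)]
    simp
  · simp_rw [div_pow]
    rw [integral_div, ← variance_eq_integral hf.aemeasurable, hvar]
    exact div_self (by positivity)

theorem ae_pi_forall {m : ℕ} {p : ℝ → Prop} (h : ∀ᵐ u ∂P, p u) :
    ∀ᵐ X ∂(Measure.pi fun _ : Fin m => P), ∀ i, p (X i) :=
  ae_all_iff.2 fun i => (Measure.quasiMeasurePreserving_eval _ i).ae h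

/-- If the weights are small relative to their standard deviation `s`, then the centred sample mean
of the weights is nearly normal, with standard deviation `s / √m`, and the latter is consistently
estimated. The degenerate case `s = 0`, in which the weights vanish, is included. -/
theorem exists_noise_bounds (P : Measure ℝ) [IsProbabilityMeasure P] {ε ρ : ℝ} (hε : 0 < ε)
    (hρ : 0 < ρ) :
    ∃ τ : ℝ, 0 < τ ∧ ∀ (m : ℕ) (f : ℝ → ℝ) (s : ℝ), 2 ≤ m → Measurable f → 0 ≤ s →
      Var[f; P] = s ^ 2 → (∀ᵐ u ∂P, |f u| ≤ τ * s * √(m : ℝ)) →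
      (∀ b r : ℝ, (Measure.pi fun _ : Fin m => P)
          {X | r < |b + ((1 / (m : ℝ)) * ∑ i, f (X i) - ∫ u, f u ∂P)|}
          ≤ absTail b (s / √(m : ℝ)) r + ENNReal.ofReal ε) ∧
        (Measure.pi fun _ : Fin m => P)
          {X | ρ * (s / √(m : ℝ)) < |√(varianceEstimate f X) - s / √(m : ℝ)|}
          ≤ ENNReal.ofReal ε := by
  obtain ⟨τ₁, hτ₁, hclt⟩ := exists_gaussianReal_Icc_le P hε
  set A : ℝ := 144 / ρ ^ 2 + 24 / ρ with hA
  have hA0 : 0 < A := by positivity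
  set τ : ℝ := min (τ₁ / 2) (√(min (ε / A) (ρ / 24))) with hτdef
  have hτ0 : 0 < τ := by positivity
  have hτ1 : 2 * τ ≤ τ₁ := by linarith [min_le_left (τ₁ / 2) (√(min (ε / A) (ρ / 24)))]
  have hτ2 : τ ^ 2 ≤ min (ε / A) (ρ / 24) := by
    have h : τ ≤ √(min (ε / A) (ρ / 24)) := min_le_right _ _
    calc τ ^ 2 ≤ √(min (ε / A) (ρ / 24)) ^ 2 := by gcongr
      _ = _ := Real.sq_sqrt (by positivity)
  have hτε : τ ^ 2 * A ≤ ε := by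
    rw [← le_div_iff₀ hA0]; exact hτ2.trans (min_le_left _ _)
  have hτρ : τ ^ 2 ≤ ρ / 24 := hτ2.trans (min_le_right _ _)
  refine ⟨τ, hτ0, fun m f s hm hf hs hvar hK => ?_⟩
  have hm0 : 0 < m := by lia
  have hm' : (2 : ℝ) ≤ m := by exact_mod_cast hm
  have hmpos : (0 : ℝ) < m := by linarith
  have hsm : 0 < √(m : ℝ) := Real.sqrt_pos.2 hmpos
  have hsm2 : √(m : ℝ) ^ 2 = m := Real.sq_sqrt hmpos.le
  rcases hs.eq_or_lt with rfl | hs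
  · have hz : ∀ᵐ u ∂P, f u = 0 := by
      filter_upwards [hK] with u hu
      rw [mul_zero, zero_mul] at hu
      exact abs_nonpos_iff.1 hu
    have hμ : ∫ u, f u ∂P = 0 := by
      rw [integral_congr_ae (g := fun _ => (0 : ℝ)) hz, integral_zero]
    have hz' := ae_pi_forall (m := m) hz
    constructor
    · intro b r
      refine le_trans ?_ le_self_add
      by_cases hr : r < |b|
      · have : absTail b (0 / √(m : ℝ)) r = 1 := by
          have : {z : ℝ | r < |b + 0 / √(m : ℝ) * z|} = Set.univ := by
            ext z; simpa using hr
          rw [absTail, this, measure_univ]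
        rw [this]
        exact prob_le_one
      · refine le_of_eq_of_le (measure_mono_null (t := {X | ¬ ∀ i, f (X i) = 0}) ?_ hz')
          zero_le
        intro X hX hX0
        simp only [Set.mem_ofPred_eq] at hX
        simp [hX0, hμ] at hX
        exact hr hX
    · refine le_of_eq_of_le (measure_mono_null (t := {X | ¬ ∀ i, f (X i) = 0}) ?_ hz') zero_le
      intro X hX hX0
      simp only [Set.mem_ofPred_eq] at hX
      simp [hX0, varianceEstimate] at hX
  · obtain ⟨Y, hY, hfY, hYD, hY1, hY2⟩ := exists_standardization hf hK hs hvar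
    have hYD' : ∀ᵐ u ∂P, |Y u| ≤ 2 * τ * √(m : ℝ) := by
      filter_upwards [hYD] with u hu
      refine hu.trans (le_of_eq ?_)
      field_simp
    set D := 2 * τ * √(m : ℝ) with hD
    have hD1 := one_le_of_abs_le hY hYD' hY2
    have hDsq : D ^ 2 = 4 * τ ^ 2 * m := by rw [hD, mul_pow, hsm2]; ring
    have hinv : 1 / (m : ℝ) ≤ 4 * τ ^ 2 := by
      rw [div_le_iff₀ hmpos]; nlinarith
    constructor
    · intro b r
      have hS : 0 < s / √(m : ℝ) := by positivity
      set S := s / √(m : ℝ) with hSdef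
      have hc := hclt m Y hY (by
        filter_upwards [hYD'] with u hu
        refine hu.trans ?_
        rw [hD]; gcongr) hY1 hY2 ((-r - b) / S) ((r - b) / S)
      have hiff : ∀ z : ℝ, z ∈ Set.Icc ((-r - b) / S) ((r - b) / S) ↔ ¬ r < |b + S * z| := by
        intro z
        rw [Set.mem_Icc, not_lt, abs_le, div_le_iff₀ hS, le_div_iff₀ hS]
        constructor <;> rintro ⟨h1, h2⟩ <;> constructor <;> linarith
      have hset : {X : Fin m → ℝ | r < |b + ((1 / (m : ℝ)) * ∑ i, f (X i) - ∫ u, f u ∂P)|}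
          = {X | (√(m : ℝ))⁻¹ * ∑ i, Y (X i) ∈ Set.Icc ((-r - b) / S) ((r - b) / S)}ᶜ := by
        ext X
        rw [Set.mem_compl_iff, Set.mem_ofPred_eq, Set.mem_ofPred_eq, hiff, not_not]
        have : (1 / (m : ℝ)) * ∑ i, f (X i) - ∫ u, f u ∂P
            = S * ((√(m : ℝ))⁻¹ * ∑ i, Y (X i)) := by
          have h1 : ∑ i, f (X i) = m * (∫ u, f u ∂P) + s * ∑ i, Y (X i) := by
            rw [Finset.sum_congr rfl fun i _ => hfY (X i)]
            simp [Finset.sum_add_distrib, Finset.mul_sum]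
          rw [h1, hSdef]
          field_simp
          rw [hsm2]
          ring
        rw [this]
      have hmeas : MeasurableSet
          {X : Fin m → ℝ | (√(m : ℝ))⁻¹ * ∑ i, Y (X i) ∈ Set.Icc ((-r - b) / S) ((r - b) / S)} :=
        measurableSet_Icc.preimage (by fun_prop)
      have hset' : {z : ℝ | r < |b + S * z|} = (Set.Icc ((-r - b) / S) ((r - b) / S))ᶜ := by
        ext z
        rw [Set.mem_compl_iff, hiff, not_not, Set.mem_ofPred_eq]
      rw [hset, absTail, hset']
      have e1 := prob_add_prob_compl (μ := Measure.pi fun _ : Fin m => P) hmeas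
      have e2 := prob_add_prob_compl (μ := gaussianReal 0 1)
        (measurableSet_Icc (a := (-r - b) / S) (b := (r - b) / S))
      refine (ENNReal.add_le_add_iff_left
        (measure_ne_top (gaussianReal 0 1) (Set.Icc ((-r - b) / S) ((r - b) / S)))).1 ?_
      rw [← add_assoc, e2]
      refine (add_le_add_left hc _).trans (le_of_eq ?_)
      rw [← e1]
      ring
    · have hY4 : ∫ u, (Y u ^ 2) ^ 2 ∂P ≤ D ^ 2 := by
        have hi := integrable_sq_of_abs_le hY hYD'
        calc ∫ u, (Y u ^ 2) ^ 2 ∂P ≤ ∫ u, D ^ 2 * Y u ^ 2 ∂P := by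
              refine integral_mono_of_nonneg (Eventually.of_forall fun u => by positivity)
                (hi.const_mul _) ?_
              filter_upwards [hYD'] with u hu
              have : Y u ^ 2 ≤ D ^ 2 := by rw [← sq_abs]; gcongr
              nlinarith [sq_nonneg (Y u)]
          _ = D ^ 2 := by rw [integral_const_mul, hY2, mul_one]
      have hYsqb : ∀ᵐ u ∂P, |Y u ^ 2| ≤ D ^ 2 := by
        filter_upwards [hYD'] with u hu
        rw [abs_pow]; gcongr
      have hρ6 : 0 < ρ / 6 := by positivity
      have hc1 := meas_le_abs_mean_sub_le (hY.pow_const 2) hYsqb hm0 hY4 hρ6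
      have hc2 := meas_le_abs_mean_sub_le hY hYD' hm0 hY2.le (Real.sqrt_pos.2 hρ6)
      rw [hY2] at hc1
      rw [hY1] at hc2
      rw [Real.sq_sqrt hρ6.le] at hc2
      simp only [sub_zero] at hc2
      refine (measure_mono ?_).trans ((measure_union_le _ _).trans ((add_le_add hc1 hc2).trans ?_))
      · intro X hX
        by_contra hcon
        simp only [Set.mem_union, Set.mem_ofPred_eq, not_or, not_le] at hcon hX
        obtain ⟨h1, h2⟩ := hcon
        refine absurd (abs_sqrt_varianceEstimate_sub_le hm hs hfY ?_ h1.le ?_) (not_le.2 hX)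
        · linarith
        · rw [← sq_abs, ← Real.sq_sqrt hρ6.le]; gcongr
      · rw [← ENNReal.ofReal_add (by positivity) (by positivity)]
        refine ENNReal.ofReal_le_ofReal (le_trans ?_ hτε)
        have e1 : D ^ 2 / (m * (ρ / 6) ^ 2) = τ ^ 2 * (144 / ρ ^ 2) := by
          rw [hDsq]; field_simp; norm_num
        have e2 : 1 / (m * (ρ / 6)) ≤ τ ^ 2 * (24 / ρ) := by
          have : 1 / (m * (ρ / 6)) = 1 / m * (6 / ρ) := by field_simp
          rw [this]
          calc 1 / (m : ℝ) * (6 / ρ) ≤ 4 * τ ^ 2 * (6 / ρ) := by gcongr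
            _ = _ := by ring
        rw [e1, hA, mul_add]
        linarith

end Noise

/-! ### Gaussian mixture densities -/

theorem continuous_gaussianPDFReal_std : Continuous (gaussianPDFReal 0 1) := by
  rw [gaussianPDFReal_def]
  fun_prop

section Density

variable (G : Measure ℝ)

theorem integrable_gaussianPDFReal_shift [IsFiniteMeasure G] (u : ℝ) :
    Integrable (fun μ => gaussianPDFReal 0 1 (u - μ)) G := by
  refine Integrable.of_bound
    (continuous_gaussianPDFReal_std.comp (by fun_prop)).aestronglyMeasurable 1
    (Eventually.of_forall fun μ => ?_)
  rw [Real.norm_eq_abs, abs_of_nonneg (gaussianPDFReal_nonneg _ _ _)]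
  exact gaussianPDFReal_std_le_one _

theorem sampleLaw_absolutelyContinuous : sampleLaw G ≪ volume :=
  withDensity_absolutelyContinuous _ _

variable [IsProbabilityMeasure G]

theorem continuous_marginalDensity : Continuous (marginalDensity G) := by
  unfold marginalDensity
  refine continuous_of_dominated (bound := fun _ => 1) (fun u => ?_) (fun u => ?_)
    (integrable_const _) (Eventually.of_forall fun μ => ?_)
  · exact (integrable_gaussianPDFReal_shift G u).aestronglyMeasurable
  · refine Eventually.of_forall fun μ => ?_
    rw [Real.norm_eq_abs, abs_of_nonneg (gaussianPDFReal_nonneg _ _ _)]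
    exact gaussianPDFReal_std_le_one _
  · exact continuous_gaussianPDFReal_std.comp (by fun_prop)

theorem marginalDensity_pos (u : ℝ) : 0 < marginalDensity G u := by
  rw [marginalDensity, integral_pos_iff_support_of_nonneg
    (fun μ => gaussianPDFReal_nonneg _ _ _) (integrable_gaussianPDFReal_shift G u)]
  have : Function.support (fun μ => gaussianPDFReal 0 1 (u - μ)) = Set.univ := by
    ext μ
    simpa using (gaussianPDFReal_pos 0 1 (u - μ) one_ne_zero).ne'
  rw [this, measure_univ]
  exact one_pos

theorem lintegral_marginalDensity :
    ∫⁻ u, ENNReal.ofReal (marginalDensity G u) = 1 := by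
  have h : ∀ u, ENNReal.ofReal (marginalDensity G u)
      = ∫⁻ μ, ENNReal.ofReal (gaussianPDFReal 0 1 (u - μ)) ∂G := fun u =>
    ofReal_integral_eq_lintegral_ofReal (integrable_gaussianPDFReal_shift G u)
      (Eventually.of_forall fun μ => gaussianPDFReal_nonneg _ _ _)
  have hm := continuous_gaussianPDFReal_std.measurable
  simp_rw [h]
  rw [lintegral_lintegral_swap (by fun_prop)]
  have h1 : ∀ μ : ℝ, ∫⁻ u, ENNReal.ofReal (gaussianPDFReal 0 1 (u - μ)) = 1 := fun μ => by
    rw [lintegral_sub_right_eq_self (fun u => ENNReal.ofReal (gaussianPDFReal 0 1 u)) μ]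
    exact lintegral_gaussianPDFReal_eq_one 0 one_ne_zero
  simp [h1]

theorem integrable_marginalDensity : Integrable (marginalDensity G) := by
  refine ⟨(continuous_marginalDensity G).aestronglyMeasurable, ?_⟩
  rw [hasFiniteIntegral_iff_ofReal
    (Eventually.of_forall fun u => (marginalDensity_pos G u).le), lintegral_marginalDensity]
  exact ENNReal.one_lt_top

theorem integral_marginalDensity : ∫ u, marginalDensity G u = 1 := by
  rw [integral_eq_lintegral_of_nonneg_ae
    (Eventually.of_forall fun u => (marginalDensity_pos G u).le)
    (continuous_marginalDensity G).aestronglyMeasurable, lintegral_marginalDensity,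
    ENNReal.toReal_one]

instance isProbabilityMeasure_sampleLaw : IsProbabilityMeasure (sampleLaw G) := by
  refine ⟨?_⟩
  rw [sampleLaw, withDensity_apply _ MeasurableSet.univ, setLIntegral_univ,
    lintegral_marginalDensity]

theorem integral_sampleLaw (Q : ℝ → ℝ) :
    ∫ u, Q u ∂(sampleLaw G) = ∫ u, Q u * marginalDensity G u := by
  rw [sampleLaw, integral_withDensity_eq_integral_toReal_smul
    (continuous_marginalDensity G).measurable.ennreal_ofReal
    (Eventually.of_forall fun _ => ENNReal.ofReal_lt_top)]
  refine integral_congr_ae (Eventually.of_forall fun u => ?_)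
  simp only [ENNReal.toReal_ofReal (marginalDensity_pos G u).le, smul_eq_mul]
  ring

theorem integrable_sampleLaw_iff {Q : ℝ → ℝ} :
    Integrable Q (sampleLaw G) ↔ Integrable fun u => Q u * marginalDensity G u := by
  rw [sampleLaw, integrable_withDensity_iff
    (continuous_marginalDensity G).measurable.ennreal_ofReal
    (Eventually.of_forall fun _ => ENNReal.ofReal_lt_top)]
  refine integrable_congr (Eventually.of_forall fun u => ?_)
  simp only [ENNReal.toReal_ofReal (marginalDensity_pos G u).le]

/-- The density is bounded away from zero on compact intervals, and both tails carry mass. -/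
theorem exists_marginalDensity_ge {M : ℝ} (hM : 0 < M) :
    ∃ κ : ℝ, 0 < κ ∧ (∀ u ∈ Set.Icc (-M) M, κ ≤ marginalDensity G u)
      ∧ κ ≤ ∫ u in Set.Iic (-M), marginalDensity G u
      ∧ κ ≤ ∫ u in Set.Ici M, marginalDensity G u := by
  obtain ⟨u₀, -, hu₀⟩ := isCompact_Icc.exists_isMinOn
    (Set.nonempty_Icc.2 (by linarith : -M ≤ M)) (continuous_marginalDensity G).continuousOn
  have hpos : ∀ s : Set ℝ, volume s ≠ 0 → 0 < ∫ u in s, marginalDensity G u := by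
    intro s hs
    rw [integral_pos_iff_support_of_nonneg (fun u => (marginalDensity_pos G u).le)
      (integrable_marginalDensity G).integrableOn]
    have : Function.support (marginalDensity G) = Set.univ := by
      ext u; simpa using (marginalDensity_pos G u).ne'
    rw [this, Measure.restrict_apply_univ]
    exact pos_iff_ne_zero.2 hs
  have h1 := hpos (Set.Iic (-M)) (by simp)
  have h2 := hpos (Set.Ici M) (by simp)
  refine ⟨min (marginalDensity G u₀) (min (∫ u in Set.Iic (-M), marginalDensity G u)
    (∫ u in Set.Ici M, marginalDensity G u)), ?_, ?_, ?_, ?_⟩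
  · exact lt_min (marginalDensity_pos G u₀) (lt_min h1 h2)
  · exact fun u hu => (min_le_left _ _).trans (hu₀ hu)
  · exact (min_le_right _ _).trans (min_le_left _ _)
  · exact (min_le_right _ _).trans (min_le_right _ _)

end Density

section Mixture

variable {G₁ G₂ : Measure ℝ} (a b : ℝ≥0)

theorem integral_mixture {f : ℝ → ℝ} (h₁ : Integrable f G₁) (h₂ : Integrable f G₂) :
    ∫ μ, f μ ∂(a • G₁ + b • G₂) = a * ∫ μ, f μ ∂G₁ + b * ∫ μ, f μ ∂G₂ := by
  rw [integral_add_measure (h₁.smul_measure_nnreal) (h₂.smul_measure_nnreal),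
    integral_smul_nnreal_measure, integral_smul_nnreal_measure]
  rfl

variable [IsProbabilityMeasure G₁] [IsProbabilityMeasure G₂]

theorem marginalDensity_mixture (u : ℝ) :
    marginalDensity (a • G₁ + b • G₂) u = a * marginalDensity G₁ u + b * marginalDensity G₂ u :=
  integral_mixture a b (integrable_gaussianPDFReal_shift G₁ u)
    (integrable_gaussianPDFReal_shift G₂ u)

theorem calibrationTarget_mixture {h : ℝ → ℝ} {x : ℝ} (Abar Fbar : ℝ)
    (h₁ : Integrable (fun μ => h μ * gaussianPDFReal 0 1 (x - μ)) G₁)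
    (h₂ : Integrable (fun μ => h μ * gaussianPDFReal 0 1 (x - μ)) G₂) :
    calibrationTarget h x Abar Fbar (a • G₁ + b • G₂)
      = a * calibrationTarget h x Abar Fbar G₁ + b * calibrationTarget h x Abar Fbar G₂ := by
  rw [calibrationTarget, numerator, integral_mixture a b h₁ h₂, denominator,
    marginalDensity_mixture, calibrationTarget, calibrationTarget, numerator, numerator,
    denominator, denominator]
  ring

end Mixture

/-! ### Functions constant on the tails, and the score of a perturbation -/

/-- Measurable functions that are constant on each of the two tails `(-∞, -M]` and `[M, ∞)`. -/
structure TailConst (M : ℝ) (R : ℝ → ℝ) : Prop where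
  measurable : Measurable R
  left : ∀ u ≤ -M, R u = R (-M)
  right : ∀ u ≥ M, R u = R M

namespace TailConst

variable {M : ℝ} {R S : ℝ → ℝ}

theorem mul (hR : TailConst M R) (hS : TailConst M S) : TailConst M fun u => R u * S u :=
  ⟨hR.measurable.mul hS.measurable, fun u hu => by rw [hR.left u hu, hS.left u hu],
    fun u hu => by rw [hR.right u hu, hS.right u hu]⟩

theorem sub (hR : TailConst M R) (hS : TailConst M S) : TailConst M fun u => R u - S u :=
  ⟨hR.measurable.sub hS.measurable, fun u hu => by rw [hR.left u hu, hS.left u hu],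
    fun u hu => by rw [hR.right u hu, hS.right u hu]⟩

theorem const_mul (hR : TailConst M R) (a : ℝ) : TailConst M fun u => a * R u :=
  ⟨hR.measurable.const_mul a, fun u hu => by rw [hR.left u hu],
    fun u hu => by rw [hR.right u hu]⟩

theorem abs (hR : TailConst M R) : TailConst M fun u => |R u| :=
  ⟨hR.measurable.abs, fun u hu => by rw [hR.left u hu], fun u hu => by rw [hR.right u hu]⟩

theorem sq (hR : TailConst M R) : TailConst M fun u => R u ^ 2 :=
  ⟨hR.measurable.pow_const 2, fun u hu => by rw [hR.left u hu],
    fun u hu => by rw [hR.right u hu]⟩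

/-- An integral against a function that is constant on the tails sees each tail as one cell. -/
theorem integral_mul (hM : 0 < M) (hR : TailConst M R) {g : ℝ → ℝ}
    (hRg : Integrable fun u => R u * g u) :
    ∫ u, R u * g u = R (-M) * (∫ u in Set.Iic (-M), g u) + (∫ u in Set.Ioo (-M) M, R u * g u)
      + R M * (∫ u in Set.Ici M, g u) := by
  have h1 : ∫ u in Set.Iic (-M), R u * g u = R (-M) * ∫ u in Set.Iic (-M), g u := by
    rw [← integral_const_mul]
    exact setIntegral_congr_fun measurableSet_Iic fun u hu => by
      simp only [hR.left u hu]
  have h2 : ∫ u in Set.Ici M, R u * g u = R M * ∫ u in Set.Ici M, g u := by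
    rw [← integral_const_mul]
    exact setIntegral_congr_fun measurableSet_Ici fun u hu => by
      simp only [hR.right u hu]
  have hsplit : Set.Ioi (-M) = Set.Ioo (-M) M ∪ Set.Ici M := by
    rw [Set.Ioo_union_Ici_eq_Ioi (by linarith)]
  have hd : Disjoint (Set.Ioo (-M) M) (Set.Ici M) := by
    rw [Set.disjoint_left]
    intro u hu hu'
    exact absurd hu.2 (not_lt.2 hu')
  rw [← h1, ← h2, ← intervalIntegral.integral_Iic_add_Ioi (b := -M) hRg.integrableOn
    hRg.integrableOn, hsplit, setIntegral_union hd measurableSet_Ici hRg.integrableOn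
    hRg.integrableOn, add_assoc]

end TailConst

/-- The function `u` is bounded by `c` in the norm `‖·‖_{∞,M}`. -/
structure Near (M c : ℝ) (u : ℝ → ℝ) : Prop where
  mid : ∀ x ∈ Set.Icc (-M) M, |u x| ≤ c
  left : |∫ x in Set.Iic (-M), u x| ≤ c
  right : |∫ x in Set.Ici M, u x| ≤ c

theorem supTailNorm_le_iff {M c : ℝ} (hc : 0 ≤ c) {u : ℝ → ℝ} :
    supTailNorm M u ≤ ENNReal.ofReal c ↔ Near M c u := by
  have h : ∀ r : ℝ, ‖r‖ₑ ≤ ENNReal.ofReal c ↔ |r| ≤ c := fun r => by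
    rw [Real.enorm_eq_ofReal_abs, ENNReal.ofReal_le_ofReal_iff hc]
  simp only [supTailNorm, max_le_iff, iSup_le_iff, h]
  exact ⟨fun ⟨h1, h2, h3⟩ => ⟨h1, h2, h3⟩, fun ⟨h1, h2, h3⟩ => ⟨h1, h2, h3⟩⟩

/-- A pilot density that is at least `κ` on `[-M, M]` and gives mass at least `κ` to each tail. -/
structure IsPilot (M κ : ℝ) (fbar : ℝ → ℝ) : Prop where
  measurable : Measurable fbar
  integrable : Integrable fbar
  pos : 0 < κ
  mid : ∀ u ∈ Set.Icc (-M) M, κ ≤ fbar u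
  left : κ ≤ ∫ u in Set.Iic (-M), fbar u
  right : κ ≤ ∫ u in Set.Ici M, fbar u

/-- The score of a perturbation `g` relative to `fbar`: the ratio `g / fbar`, in which each tail
is merged into one cell. It represents the functional `Q ↦ ∫ Q g` in the inner product
`∫ Q R fbar` on functions constant on the tails. -/
noncomputable def score (M : ℝ) (fbar g : ℝ → ℝ) (u : ℝ) : ℝ :=
  if u ≤ -M then (∫ v in Set.Iic (-M), g v) / ∫ v in Set.Iic (-M), fbar v
  else if M ≤ u then (∫ v in Set.Ici M, g v) / ∫ v in Set.Ici M, fbar v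
  else g u / fbar u

section Score

variable {M κ c : ℝ} {fbar g : ℝ → ℝ}

theorem score_left {u : ℝ} (hu : u ≤ -M) :
    score M fbar g u = (∫ v in Set.Iic (-M), g v) / ∫ v in Set.Iic (-M), fbar v :=
  if_pos hu

theorem score_right (hM : 0 < M) {u : ℝ} (hu : M ≤ u) :
    score M fbar g u = (∫ v in Set.Ici M, g v) / ∫ v in Set.Ici M, fbar v := by
  rw [score, if_neg (by linarith), if_pos hu]

theorem score_mid {u : ℝ} (hu : u ∈ Set.Ioo (-M) M) : score M fbar g u = g u / fbar u := by
  rw [score, if_neg (by linarith [hu.1]), if_neg (by linarith [hu.2])]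

theorem tailConst_score (hM : 0 < M) (hf : Measurable fbar) (hg : Measurable g) :
    TailConst M (score M fbar g) where
  measurable := by
    unfold score
    refine Measurable.ite measurableSet_Iic measurable_const ?_
    exact Measurable.ite measurableSet_Ici measurable_const (hg.div hf)
  left u hu := by rw [score_left hu, score_left le_rfl]
  right u hu := by rw [score_right hM hu, score_right hM le_rfl]

theorem abs_score_le (hM : 0 < M) (hp : IsPilot M κ fbar) (hg : Near M c g) (u : ℝ) :
    |score M fbar g u| ≤ c / κ := by
  have hc : 0 ≤ c := (abs_nonneg _).trans hg.left
  have key : ∀ a b : ℝ, |a| ≤ c → κ ≤ b → |a / b| ≤ c / κ := fun a b ha hb => by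
    have := hp.pos
    rw [abs_div, abs_of_pos (by linarith : 0 < b)]
    gcongr
  by_cases h1 : u ≤ -M
  · rw [score_left h1]; exact key _ _ hg.left hp.left
  by_cases h2 : M ≤ u
  · rw [score_right hM h2]; exact key _ _ hg.right hp.right
  · rw [not_le] at h1 h2
    rw [score_mid ⟨h1, h2⟩]
    exact key _ _ (hg.mid u ⟨h1.le, h2.le⟩) (hp.mid u ⟨h1.le, h2.le⟩)

theorem score_mixture {g₁ g₂ : ℝ → ℝ} (h₁ : Integrable g₁) (h₂ : Integrable g₂) (a b u : ℝ) :
    score M fbar (fun v => a * g₁ v + b * g₂ v) u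
      = a * score M fbar g₁ u + b * score M fbar g₂ u := by
  have hi : ∀ s : Set ℝ, ∫ v in s, (a * g₁ v + b * g₂ v)
      = a * (∫ v in s, g₁ v) + b * ∫ v in s, g₂ v := fun s => by
    rw [integral_add (h₁.integrableOn.const_mul a) (h₂.integrableOn.const_mul b),
      integral_const_mul, integral_const_mul]
  unfold score
  rw [hi, hi]
  split_ifs <;> ring

/-- Square-integrable weights are integrable against `fbar`, and so are their products with
bounded functions. -/
theorem integrable_mul_mul_of_sq (hf : Integrable fbar) {Q S : ℝ → ℝ} (hQ : Measurable Q)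
    (hS : Measurable S) (hQ2 : Integrable fun u => Q u ^ 2 * fbar u) {K : ℝ}
    (hK : ∀ u, |S u| ≤ K) : Integrable fun u => Q u * S u * fbar u := by
  have hK0 : 0 ≤ K := (abs_nonneg _).trans (hK 0)
  refine Integrable.mono' ((hQ2.norm.add hf.norm).const_mul K)
    ((hQ.mul hS).aestronglyMeasurable.mul hf.aestronglyMeasurable)
    (Eventually.of_forall fun u => ?_)
  simp only [norm_mul, Real.norm_eq_abs, norm_pow, Pi.add_apply]
  have h1 : |Q u| ≤ |Q u| ^ 2 + 1 := by nlinarith [sq_nonneg (|Q u| - 1)]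
  have h2 := abs_nonneg (fbar u)
  calc |Q u| * |S u| * |fbar u| ≤ (|Q u| ^ 2 + 1) * K * |fbar u| := by
        gcongr
        exact hK u
    _ = K * (|Q u| ^ 2 * |fbar u| + |fbar u|) := by ring

/-- The score represents integration against the perturbation. -/
theorem integral_mul_score (hM : 0 < M) (hp : IsPilot M κ fbar) (hg : Measurable g)
    {Q : ℝ → ℝ} (hQ : TailConst M Q) (hQg : Integrable fun u => Q u * g u)
    (hQs : Integrable fun u => Q u * score M fbar g u * fbar u) :
    ∫ u, Q u * score M fbar g u * fbar u = ∫ u, Q u * g u := by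
  have hs := tailConst_score hM hp.measurable hg
  rw [hQ.integral_mul hM hQg, (hQ.mul hs).integral_mul hM hQs, score_left le_rfl,
    score_right hM le_rfl]
  have hl : ∫ v in Set.Iic (-M), fbar v ≠ 0 := (hp.pos.trans_le hp.left).ne'
  have hr : ∫ v in Set.Ici M, fbar v ≠ 0 := (hp.pos.trans_le hp.right).ne'
  have hm : ∫ u in Set.Ioo (-M) M, Q u * score M fbar g u * fbar u
      = ∫ u in Set.Ioo (-M) M, Q u * g u := by
    refine setIntegral_congr_fun measurableSet_Ioo fun u hu => ?_
    have : fbar u ≠ 0 := (hp.pos.trans_le (hp.mid u ⟨hu.1.le, hu.2.le⟩)).ne'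
    simp only [score_mid hu]
    field_simp
  rw [hm]
  field_simp

/-- Integration against the pilot is a positive functional on functions constant on the tails. -/
theorem integral_mul_pilot_nonneg (hM : 0 < M) (hp : IsPilot M κ fbar) {R : ℝ → ℝ}
    (hR : TailConst M R) (hR0 : ∀ u, 0 ≤ R u) (hRi : Integrable fun u => R u * fbar u) :
    0 ≤ ∫ u, R u * fbar u := by
  have := hp.pos
  rw [hR.integral_mul hM hRi]
  have h1 : 0 ≤ ∫ u in Set.Ioo (-M) M, R u * fbar u :=
    setIntegral_nonneg measurableSet_Ioo fun u hu =>
      mul_nonneg (hR0 u) (this.le.trans (hp.mid u ⟨hu.1.le, hu.2.le⟩))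
  have h2 := mul_nonneg (hR0 (-M)) (this.le.trans hp.left)
  have h3 := mul_nonneg (hR0 M) (this.le.trans hp.right)
  linarith

/-- A nonnegative function constant on the tails with vanishing integral against the pilot
vanishes almost everywhere. -/
theorem ae_eq_zero_of_integral_mul_pilot (hM : 0 < M) (hp : IsPilot M κ fbar) {R : ℝ → ℝ}
    (hR : TailConst M R) (hR0 : ∀ u, 0 ≤ R u) (hRi : Integrable fun u => R u * fbar u)
    (h0 : ∫ u, R u * fbar u ≤ 0) : ∀ᵐ u, R u = 0 := by
  have hκ := hp.pos
  rw [hR.integral_mul hM hRi] at h0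
  have hmid0 : ∀ u ∈ Set.Ioo (-M) M, 0 ≤ R u * fbar u := fun u hu =>
    mul_nonneg (hR0 u) (hκ.le.trans (hp.mid u ⟨hu.1.le, hu.2.le⟩))
  have h1 : 0 ≤ ∫ u in Set.Ioo (-M) M, R u * fbar u := setIntegral_nonneg measurableSet_Ioo hmid0
  have h2 : R (-M) * κ ≤ R (-M) * ∫ u in Set.Iic (-M), fbar u :=
    mul_le_mul_of_nonneg_left hp.left (hR0 _)
  have h3 : R M * κ ≤ R M * ∫ u in Set.Ici M, fbar u :=
    mul_le_mul_of_nonneg_left hp.right (hR0 _)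
  have h2' := mul_nonneg (hR0 (-M)) hκ.le
  have h3' := mul_nonneg (hR0 M) hκ.le
  have hl : R (-M) = 0 := by nlinarith [hR0 (-M)]
  have hr : R M = 0 := by nlinarith [hR0 M]
  have hm : ∫ u in Set.Ioo (-M) M, R u * fbar u = 0 := by linarith
  rw [setIntegral_eq_zero_iff_of_nonneg_ae
    ((ae_restrict_iff' measurableSet_Ioo).2 (Eventually.of_forall hmid0)) hRi.integrableOn] at hm
  filter_upwards [(ae_restrict_iff' measurableSet_Ioo).1 hm] with u hu
  by_cases h1 : u ≤ -M
  · rw [hR.left u h1, hl]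
  by_cases h2 : M ≤ u
  · rw [hR.right u h2, hr]
  · rw [not_le] at h1 h2
    have h4 := hu ⟨h1, h2⟩
    have h5 : fbar u ≠ 0 := (hκ.trans_le (hp.mid u ⟨h1.le, h2.le⟩)).ne'
    simpa [h5] using h4

/-- Integrals of functions constant on the tails against a density close to the pilot. -/
theorem abs_integral_mul_sub_le (hM : 0 < M) (hp : IsPilot M κ fbar) (hg : Near M c g)
    {R : ℝ → ℝ} (hR : TailConst M R) (hRg : Integrable fun u => R u * g u)
    (hRi : Integrable fun u => R u * fbar u) :
    |∫ u, R u * g u| ≤ c / κ * ∫ u, |R u| * fbar u := by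
  have hκ := hp.pos
  have hc : 0 ≤ c := (abs_nonneg _).trans hg.left
  have hmid : ∀ u ∈ Set.Ioo (-M) M, |fbar u| = fbar u := fun u hu =>
    abs_of_pos (hκ.trans_le (hp.mid u ⟨hu.1.le, hu.2.le⟩))
  have habs : Integrable fun u => |R u| * fbar u := by
    refine hRi.congr' ((hR.measurable.abs.aestronglyMeasurable).mul
      hp.integrable.aestronglyMeasurable) (Eventually.of_forall fun u => ?_)
    simp
  rw [hR.integral_mul hM hRg, hR.abs.integral_mul hM habs]
  have hcell : ∀ r a b : ℝ, |a| ≤ c → κ ≤ b → |r * a| ≤ c / κ * (|r| * b) := fun r a b ha hb => by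
    rw [abs_mul]
    have : c ≤ c / κ * b := by
      rw [div_mul_eq_mul_div, le_div_iff₀ hκ]; gcongr
    calc |r| * |a| ≤ |r| * (c / κ * b) := by gcongr; linarith
      _ = _ := by ring
  have h1 := hcell (R (-M)) _ _ hg.left hp.left
  have h2 := hcell (R M) _ _ hg.right hp.right
  have h3 : |∫ u in Set.Ioo (-M) M, R u * g u|
      ≤ c / κ * ∫ u in Set.Ioo (-M) M, |R u| * fbar u := by
    rw [← integral_const_mul]
    refine norm_integral_le_of_norm_le (f := fun u => R u * g u) (habs.integrableOn.const_mul _) ?_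
    refine (ae_restrict_iff' measurableSet_Ioo).2 (Eventually.of_forall fun u hu => ?_)
    exact hcell _ _ _ (hg.mid u ⟨hu.1.le, hu.2.le⟩) (hp.mid u ⟨hu.1.le, hu.2.le⟩)
  rw [mul_add, mul_add]
  exact (abs_add_three _ _ _).trans (by gcongr)

end Score

/-! ### The modulus problem and the minimax weights -/

/-- A convex class of probability measures whose marginal densities are within `c` of the pilot
`fbar`, together with a bounded affine functional `L` on it. -/
structure LocalProblem (M κ c : ℝ) (fbar : ℝ → ℝ) (𝒞 : Set (Measure ℝ)) (L : Measure ℝ → ℝ) :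
    Prop where
  pos : 0 < M
  pilot : IsPilot M κ fbar
  prob : ∀ G ∈ 𝒞, IsProbabilityMeasure G
  near : ∀ G ∈ 𝒞, Near M c fun u => marginalDensity G u - fbar u
  convex : ∀ G₁ ∈ 𝒞, ∀ G₂ ∈ 𝒞, ∀ a b : ℝ≥0, a + b = 1 → a • G₁ + b • G₂ ∈ 𝒞
  affine : ∀ G₁ ∈ 𝒞, ∀ G₂ ∈ 𝒞, ∀ a b : ℝ≥0, L (a • G₁ + b • G₂) = a * L G₁ + b * L G₂
  bdd : ∃ K : ℝ, ∀ G ∈ 𝒞, |L G| ≤ K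

/-- The score of the difference of two marginal densities. -/
noncomputable def pairScore (M : ℝ) (fbar : ℝ → ℝ) (G₁ G₂ : Measure ℝ) : ℝ → ℝ :=
  score M fbar fun u => marginalDensity G₁ u - marginalDensity G₂ u

/-- The inner product `∫ Q R fbar` on weight functions. -/
noncomputable def weightInner (fbar Q R : ℝ → ℝ) : ℝ :=
  ∫ u, Q u * R u * fbar u

theorem Near.sub {M c d : ℝ} {u v : ℝ → ℝ} (hu : Near M c u) (hv : Near M d v)
    (hui : Integrable u) (hvi : Integrable v) : Near M (c + d) fun x => u x - v x where
  mid x hx := (abs_sub _ _).trans (add_le_add (hu.mid x hx) (hv.mid x hx))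
  left := by
    rw [integral_sub hui.integrableOn hvi.integrableOn]
    exact (abs_sub _ _).trans (add_le_add hu.left hv.left)
  right := by
    rw [integral_sub hui.integrableOn hvi.integrableOn]
    exact (abs_sub _ _).trans (add_le_add hu.right hv.right)

theorem Near.mixture {M c : ℝ} {u v : ℝ → ℝ} (hu : Near M c u) (hv : Near M c v)
    (hui : Integrable u) (hvi : Integrable v) {a b : ℝ} (ha : 0 ≤ a) (hb : 0 ≤ b)
    (hab : a + b = 1) : Near M c fun x => a * u x + b * v x := by
  have key : ∀ r s : ℝ, |r| ≤ c → |s| ≤ c → |a * r + b * s| ≤ c := fun r s hr hs => by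
    calc |a * r + b * s| ≤ |a * r| + |b * s| := abs_add_le _ _
      _ = a * |r| + b * |s| := by rw [abs_mul, abs_mul, abs_of_nonneg ha, abs_of_nonneg hb]
      _ ≤ a * c + b * c := by gcongr
      _ = c := by rw [← add_mul, hab, one_mul]
  have hi : ∀ s : Set ℝ, ∫ x in s, (a * u x + b * v x) = a * (∫ x in s, u x) + b * ∫ x in s, v x :=
    fun s => by
      rw [integral_add (hui.integrableOn.const_mul a) (hvi.integrableOn.const_mul b),
        integral_const_mul, integral_const_mul]
  exact ⟨fun x hx => key _ _ (hu.mid x hx) (hv.mid x hx),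
    by rw [hi]; exact key _ _ hu.left hv.left, by rw [hi]; exact key _ _ hu.right hv.right⟩

namespace LocalProblem

variable {M κ c : ℝ} {fbar : ℝ → ℝ} {𝒞 : Set (Measure ℝ)} {L : Measure ℝ → ℝ}
  {G₁ G₂ H₁ H₂ : Measure ℝ}

theorem integrable_density (hP : LocalProblem M κ c fbar 𝒞 L) (h : G₁ ∈ 𝒞) :
    Integrable (marginalDensity G₁) := by
  have := hP.prob _ h
  exact integrable_marginalDensity G₁

theorem integrable_diff (hP : LocalProblem M κ c fbar 𝒞 L) (h₁ : G₁ ∈ 𝒞) (h₂ : G₂ ∈ 𝒞) :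
    Integrable fun u => marginalDensity G₁ u - marginalDensity G₂ u :=
  (hP.integrable_density h₁).sub (hP.integrable_density h₂)

theorem measurable_diff (hP : LocalProblem M κ c fbar 𝒞 L) (h₁ : G₁ ∈ 𝒞) (h₂ : G₂ ∈ 𝒞) :
    Measurable fun u => marginalDensity G₁ u - marginalDensity G₂ u := by
  have := hP.prob _ h₁
  have := hP.prob _ h₂
  exact (continuous_marginalDensity G₁).measurable.sub (continuous_marginalDensity G₂).measurable

theorem near_diff (hP : LocalProblem M κ c fbar 𝒞 L) (h₁ : G₁ ∈ 𝒞) (h₂ : G₂ ∈ 𝒞) :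
    Near M (c + c) fun u => marginalDensity G₁ u - marginalDensity G₂ u := by
  have h := (hP.near _ h₁).sub (hP.near _ h₂)
    ((hP.integrable_density h₁).sub hP.pilot.integrable)
    ((hP.integrable_density h₂).sub hP.pilot.integrable)
  simpa using h

theorem tailConst_pairScore (hP : LocalProblem M κ c fbar 𝒞 L) (h₁ : G₁ ∈ 𝒞) (h₂ : G₂ ∈ 𝒞) :
    TailConst M (pairScore M fbar G₁ G₂) :=
  tailConst_score hP.pos hP.pilot.measurable (hP.measurable_diff h₁ h₂)

theorem abs_pairScore_le (hP : LocalProblem M κ c fbar 𝒞 L) (h₁ : G₁ ∈ 𝒞) (h₂ : G₂ ∈ 𝒞) (u : ℝ) :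
    |pairScore M fbar G₁ G₂ u| ≤ (c + c) / κ :=
  abs_score_le hP.pos hP.pilot (hP.near_diff h₁ h₂) u

/-- Weights with a finite variance proxy have integrable products with scores. -/
theorem integrable_mul_pairScore (hP : LocalProblem M κ c fbar 𝒞 L) (h₁ : G₁ ∈ 𝒞) (h₂ : G₂ ∈ 𝒞)
    {Q : ℝ → ℝ} (hQ : Measurable Q) (hQ2 : Integrable fun u => Q u ^ 2 * fbar u) :
    Integrable fun u => Q u * pairScore M fbar G₁ G₂ u * fbar u :=
  integrable_mul_mul_of_sq hP.pilot.integrable hQ (hP.tailConst_pairScore h₁ h₂).measurable hQ2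
    (hP.abs_pairScore_le h₁ h₂)

theorem integrable_pairScore_sq (hP : LocalProblem M κ c fbar 𝒞 L) (h₁ : G₁ ∈ 𝒞) (h₂ : G₂ ∈ 𝒞) :
    Integrable fun u => pairScore M fbar G₁ G₂ u ^ 2 * fbar u := by
  have hs := (hP.tailConst_pairScore h₁ h₂).measurable
  refine hP.pilot.integrable.bdd_mul (c := ((c + c) / κ) ^ 2)
    (hs.pow_const 2).aestronglyMeasurable (Eventually.of_forall fun u => ?_)
  rw [Real.norm_eq_abs, abs_pow]
  gcongr
  exact hP.abs_pairScore_le h₁ h₂ u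

/-- The difference of the expectations of a weight function is its inner product with the score. -/
theorem integral_sub_integral (hP : LocalProblem M κ c fbar 𝒞 L) (h₁ : G₁ ∈ 𝒞) (h₂ : G₂ ∈ 𝒞)
    {Q : ℝ → ℝ} (hQ : TailConst M Q) (hQ2 : Integrable fun u => Q u ^ 2 * fbar u)
    (hi₁ : Integrable Q (sampleLaw G₁)) (hi₂ : Integrable Q (sampleLaw G₂)) :
    (∫ u, Q u ∂(sampleLaw G₁)) - ∫ u, Q u ∂(sampleLaw G₂)
      = weightInner fbar Q (pairScore M fbar G₁ G₂) := by
  have := hP.prob _ h₁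
  have := hP.prob _ h₂
  rw [integrable_sampleLaw_iff] at hi₁ hi₂
  have hQg : Integrable fun u => Q u * (marginalDensity G₁ u - marginalDensity G₂ u) := by
    simp_rw [mul_sub]; exact hi₁.sub hi₂
  rw [integral_sampleLaw, integral_sampleLaw, ← integral_sub hi₁ hi₂, weightInner]
  simp_rw [← mul_sub]
  exact (integral_mul_score hP.pos hP.pilot (hP.measurable_diff h₁ h₂) hQ hQg
    (hP.integrable_mul_pairScore h₁ h₂ hQ.measurable hQ2)).symm

theorem chiSqDist_eq (hP : LocalProblem M κ c fbar 𝒞 L) (h₁ : G₁ ∈ 𝒞) (h₂ : G₂ ∈ 𝒞) :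
    chiSqDist M fbar G₁ G₂ = ∫ u, pairScore M fbar G₁ G₂ u ^ 2 * fbar u := by
  have hs := hP.tailConst_pairScore h₁ h₂
  have hκ := hP.pilot.pos
  have hl : ∫ v in Set.Iic (-M), fbar v ≠ 0 := (hκ.trans_le hP.pilot.left).ne'
  have hr : ∫ v in Set.Ici M, fbar v ≠ 0 := (hκ.trans_le hP.pilot.right).ne'
  rw [hs.sq.integral_mul hP.pos (hP.integrable_pairScore_sq h₁ h₂), pairScore,
    score_left le_rfl, score_right hP.pos le_rfl, chiSqDist]
  have hm : ∫ u in Set.Icc (-M) M, (marginalDensity G₁ u - marginalDensity G₂ u) ^ 2 / fbar u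
      = ∫ u in Set.Ioo (-M) M,
        score M fbar (fun u => marginalDensity G₁ u - marginalDensity G₂ u) u ^ 2 * fbar u := by
    rw [integral_Icc_eq_integral_Ioo]
    refine setIntegral_congr_fun measurableSet_Ioo fun u hu => ?_
    have : fbar u ≠ 0 := (hκ.trans_le (hP.pilot.mid u ⟨hu.1.le, hu.2.le⟩)).ne'
    simp only [score_mid hu]
    field_simp
  rw [hm]
  field_simp

theorem chiSqDist_nonneg (hP : LocalProblem M κ c fbar 𝒞 L) (h₁ : G₁ ∈ 𝒞) (h₂ : G₂ ∈ 𝒞) :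
    0 ≤ chiSqDist M fbar G₁ G₂ := by
  rw [hP.chiSqDist_eq h₁ h₂]
  exact integral_mul_pilot_nonneg hP.pos hP.pilot (hP.tailConst_pairScore h₁ h₂).sq
    (fun u => sq_nonneg _) (hP.integrable_pairScore_sq h₁ h₂)

/-- The weighted distance along a segment joining two pairs of distributions. -/
theorem chiSqDist_mixture (hP : LocalProblem M κ c fbar 𝒞 L) (h₁ : G₁ ∈ 𝒞) (h₂ : G₂ ∈ 𝒞)
    (k₁ : H₁ ∈ 𝒞) (k₂ : H₂ ∈ 𝒞) {a b : ℝ≥0} (hab : a + b = 1) :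
    chiSqDist M fbar (a • G₁ + b • H₁) (a • G₂ + b • H₂)
      = a ^ 2 * chiSqDist M fbar G₁ G₂
        + 2 * a * b * weightInner fbar (pairScore M fbar G₁ G₂) (pairScore M fbar H₁ H₂)
        + b ^ 2 * chiSqDist M fbar H₁ H₂ := by
  have := hP.prob _ h₁
  have := hP.prob _ h₂
  have := hP.prob _ k₁
  have := hP.prob _ k₂
  have hs : ∀ u, pairScore M fbar (a • G₁ + b • H₁) (a • G₂ + b • H₂) u
      = a * pairScore M fbar G₁ G₂ u + b * pairScore M fbar H₁ H₂ u := fun u => by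
    rw [pairScore, pairScore, pairScore, ← score_mixture (hP.integrable_diff h₁ h₂)
      (hP.integrable_diff k₁ k₂)]
    congr 1
    ext v
    rw [marginalDensity_mixture, marginalDensity_mixture]
    ring
  have hi := hP.integrable_mul_pairScore k₁ k₂ (hP.tailConst_pairScore h₁ h₂).measurable
    (hP.integrable_pairScore_sq h₁ h₂)
  have i₁ := hP.integrable_pairScore_sq h₁ h₂
  have i₂ := hP.integrable_pairScore_sq k₁ k₂
  rw [hP.chiSqDist_eq (hP.convex _ h₁ _ k₁ a b hab) (hP.convex _ h₂ _ k₂ a b hab),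
    hP.chiSqDist_eq h₁ h₂, hP.chiSqDist_eq k₁ k₂, weightInner, ← integral_const_mul,
    ← integral_const_mul, ← integral_const_mul, ← integral_add, ← integral_add]
  · refine integral_congr_ae (Eventually.of_forall fun u => ?_)
    simp only [hs]
    ring
  · exact (i₁.const_mul _).add (hi.const_mul _)
  · exact i₂.const_mul _
  · exact i₁.const_mul _
  · exact hi.const_mul _

theorem le_modulus (hP : LocalProblem M κ c fbar 𝒞 L) (h₁ : G₁ ∈ 𝒞) (h₂ : G₂ ∈ 𝒞) {t : ℝ}
    (ht : chiSqDist M fbar G₁ G₂ ≤ t ^ 2) : L G₁ - L G₂ ≤ modulus M 𝒞 fbar L t := by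
  obtain ⟨K, hK⟩ := hP.bdd
  refine le_csSup ⟨K + K, ?_⟩ ⟨G₁, h₁, G₂, h₂, ht, rfl⟩
  rintro r ⟨A, hA, B, hB, -, rfl⟩
  linarith [(abs_le.1 (hK A hA)).2, (abs_le.1 (hK B hB)).1]

theorem modulus_nonneg (hP : LocalProblem M κ c fbar 𝒞 L) (h : G₁ ∈ 𝒞) (t : ℝ) :
    0 ≤ modulus M 𝒞 fbar L t := by
  have h0 : chiSqDist M fbar G₁ G₁ = 0 := by simp [chiSqDist]
  have := hP.le_modulus h h (t := t) (by rw [h0]; positivity)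
  linarith

/-- Supergradients of the modulus are nonnegative, because the modulus is nondecreasing. -/
theorem nonneg_of_isSupergradient (hP : LocalProblem M κ c fbar 𝒞 L) {δ s : ℝ} (hδ : 0 < δ)
    (hs : IsSupergradient (modulus M 𝒞 fbar L) δ s)
    (hatt : ModulusAttained M 𝒞 fbar L δ) : 0 ≤ s := by
  obtain ⟨G₁, h₁, G₂, h₂, hχ, hω⟩ := hatt
  have h1 := hP.le_modulus h₁ h₂ (t := δ + 1) (hχ.trans (by gcongr; linarith))
  have h2 := hs (δ + 1) (by linarith)
  linarith

/-- First-order optimality for the modulus problem: along the segment from the extremal pair to any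
other pair, the modulus stays below its supporting line. -/
theorem sub_le_of_isSupergradient (hP : LocalProblem M κ c fbar 𝒞 L) {δ s : ℝ} (hδ : 0 < δ)
    (hs : IsSupergradient (modulus M 𝒞 fbar L) δ s) (h₁ : G₁ ∈ 𝒞) (h₂ : G₂ ∈ 𝒞)
    (hχ : chiSqDist M fbar G₁ G₂ ≤ δ ^ 2) (hω : L G₁ - L G₂ = modulus M 𝒞 fbar L δ)
    (k₁ : H₁ ∈ 𝒞) (k₂ : H₂ ∈ 𝒞) :
    L H₁ - L H₂ ≤ modulus M 𝒞 fbar L δ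
      + s / δ * (weightInner fbar (pairScore M fbar G₁ G₂) (pairScore M fbar H₁ H₂) - δ ^ 2) := by
  set ω := modulus M 𝒞 fbar L δ
  set p := weightInner fbar (pairScore M fbar G₁ G₂) (pairScore M fbar H₁ H₂)
  set χ := chiSqDist M fbar H₁ H₂
  set D := s / (2 * δ) * (δ ^ 2 - 2 * p + χ) with hD
  have key : ∀ l : ℝ, 0 < l → l ≤ 1 →
      L H₁ - L H₂ ≤ ω + s / δ * (p - δ ^ 2) + l * D := by
    intro l hl hl1
    obtain ⟨b, rfl⟩ : ∃ b : ℝ≥0, (b : ℝ) = l := ⟨⟨l, hl.le⟩, rfl⟩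
    have hb1 : b ≤ 1 := by exact_mod_cast hl1
    have hab : (1 - b) + b = 1 := tsub_add_cancel_of_le hb1
    have ha : ((1 - b : ℝ≥0) : ℝ) = 1 - b := NNReal.coe_sub hb1
    have hchi := hP.chiSqDist_mixture h₁ h₂ k₁ k₂ hab
    have hnn := hP.chiSqDist_nonneg (hP.convex _ h₁ _ k₁ _ _ hab) (hP.convex _ h₂ _ k₂ _ _ hab)
    rw [ha] at hchi
    set X := chiSqDist M fbar ((1 - b) • G₁ + b • H₁) ((1 - b) • G₂ + b • H₂)
    -- The radius `(X + δ²) / (2δ)` is at least `√X`, and is positive even if `X = 0`.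
    have ht : X ≤ ((X + δ ^ 2) / (2 * δ)) ^ 2 := by
      rw [div_pow, le_div_iff₀ (by positivity)]
      nlinarith [sq_nonneg (X - δ ^ 2)]
    have hm := hP.le_modulus (hP.convex _ h₁ _ k₁ _ _ hab) (hP.convex _ h₂ _ k₂ _ _ hab) ht
    have hsup := hs ((X + δ ^ 2) / (2 * δ)) (by positivity)
    rw [hP.affine _ h₁ _ k₁, hP.affine _ h₂ _ k₂, ha] at hm
    have hs0 := hP.nonneg_of_isSupergradient hδ hs ⟨G₁, h₁, G₂, h₂, hχ, hω⟩
    have hX : X - δ ^ 2 ≤ (b : ℝ) * (2 * (p - δ ^ 2) + b * (δ ^ 2 - 2 * p + χ)) := by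
      have : (1 - (b : ℝ)) ^ 2 * chiSqDist M fbar G₁ G₂ ≤ (1 - (b : ℝ)) ^ 2 * δ ^ 2 := by gcongr
      rw [hchi]
      nlinarith
    have hlin : s * ((X + δ ^ 2) / (2 * δ) - δ)
        ≤ b * (s / δ * (p - δ ^ 2) + b * D) := by
      have e1 : s * ((X + δ ^ 2) / (2 * δ) - δ) = s / (2 * δ) * (X - δ ^ 2) := by
        field_simp; ring
      have e2 : (b : ℝ) * (s / δ * (p - δ ^ 2) + b * D)
          = s / (2 * δ) * (b * (2 * (p - δ ^ 2) + b * (δ ^ 2 - 2 * p + χ))) := by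
        rw [hD]; field_simp
      rw [e1, e2]
      gcongr
    have hfin : (b : ℝ) * (L H₁ - L H₂) ≤ b * (ω + s / δ * (p - δ ^ 2) + b * D) := by
      have : (1 - (b : ℝ)) * (L G₁ - L G₂) + b * (L H₁ - L H₂)
          ≤ ω + b * (s / δ * (p - δ ^ 2) + b * D) := by linarith
      rw [hω] at this
      nlinarith
    exact le_of_mul_le_mul_left hfin hl
  have hlim : Tendsto (fun l : ℝ => ω + s / δ * (p - δ ^ 2) + l * D) (𝓝[>] 0)
      (𝓝 (ω + s / δ * (p - δ ^ 2) + 0 * D)) := by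
    refine tendsto_nhdsWithin_of_tendsto_nhds ?_
    exact (continuous_const.add (continuous_id.mul continuous_const)).tendsto 0
  rw [zero_mul, add_zero] at hlim
  refine ge_of_tendsto hlim ?_
  filter_upwards [Ioc_mem_nhdsGT one_pos] with l hl
  exact key l hl.1 hl.2

end LocalProblem

theorem integral_sub_mul_add_mul {A B D : ℝ → ℝ} (hA : Integrable A) (hB : Integrable B)
    (hD : Integrable D) (b d : ℝ) :
    ∫ u, (A u - b * B u + d * D u) = (∫ u, A u) - b * (∫ u, B u) + d * ∫ u, D u := by
  have h : Integrable fun u => A u - b * B u := hA.sub (hB.const_mul b)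
  rw [integral_add h (hD.const_mul d), integral_sub hA (hB.const_mul b), integral_const_mul,
    integral_const_mul]

/-- Real numbers at distance at most `D` from one another lie within `D / 2` of a common centre. -/
theorem exists_center {ι : Type*} {s : Set ι} {f : ι → ℝ} {D : ℝ} (hs : s.Nonempty)
    (h : ∀ i ∈ s, ∀ j ∈ s, f i - f j ≤ D) : ∃ q : ℝ, ∀ i ∈ s, |q + f i| ≤ D / 2 := by
  obtain ⟨i₀, hi₀⟩ := hs
  have hne : (f '' s).Nonempty := ⟨f i₀, i₀, hi₀, rfl⟩
  have hb : ∀ j ∈ s, ∀ y ∈ f '' s, y ≤ f j + D := by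
    rintro j hj y ⟨i, hi, rfl⟩
    linarith [h i hi j hj]
  refine ⟨-sSup (f '' s) + D / 2, fun i hi => ?_⟩
  have h1 : f i ≤ sSup (f '' s) := le_csSup ⟨_, hb i₀ hi₀⟩ ⟨i, hi, rfl⟩
  have h2 : sSup (f '' s) ≤ f i + D := csSup_le hne (hb i hi)
  rw [abs_le]
  constructor <;> linarith

theorem worstSqBias_le {𝒞 : Set (Measure ℝ)} {L : Measure ℝ → ℝ} {Q₀ : ℝ} {Q : ℝ → ℝ} {β : ℝ}
    (h : ∀ G ∈ 𝒞, |bias Q₀ Q L G| ≤ β) : worstSqBias 𝒞 L Q₀ Q ≤ ENNReal.ofReal (β ^ 2) := by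
  refine iSup₂_le fun G hG => ENNReal.ofReal_le_ofReal ?_
  rw [← sq_abs]
  have := h G hG
  gcongr

theorem abs_bias_le_worstBias {𝒞 : Set (Measure ℝ)} {L : Measure ℝ → ℝ} {Q₀ : ℝ} {Q : ℝ → ℝ}
    (hfin : worstSqBias 𝒞 L Q₀ Q ≠ ⊤) {G : Measure ℝ} (hG : G ∈ 𝒞) :
    |bias Q₀ Q L G| ≤ worstBias 𝒞 L Q₀ Q := by
  refine Real.abs_le_sqrt ?_
  have h : ENNReal.ofReal (bias Q₀ Q L G ^ 2) ≤ worstSqBias 𝒞 L Q₀ Q :=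
    le_iSup₂ (f := fun G (_ : G ∈ 𝒞) => ENNReal.ofReal (bias Q₀ Q L G ^ 2)) G hG
  exact (ENNReal.ofReal_le_iff_le_toReal hfin).1 h

theorem IsFeasible.tailConst {M : ℝ} {𝒞 : Set (Measure ℝ)} {fbar : ℝ → ℝ} {m : ℕ} {Γ : ℝ}
    {Q : ℝ → ℝ} (h : IsFeasible M 𝒞 fbar m Γ Q) : TailConst M Q :=
  ⟨h.measurable, h.left_tail, h.right_tail⟩

namespace LocalProblem

variable {M κ c : ℝ} {fbar : ℝ → ℝ} {𝒞 : Set (Measure ℝ)} {L : Measure ℝ → ℝ}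
  {G₁ G₂ : Measure ℝ}

theorem bias_sub_bias (hP : LocalProblem M κ c fbar 𝒞 L) (h₁ : G₁ ∈ 𝒞) (h₂ : G₂ ∈ 𝒞)
    {m : ℕ} {Γ Q₀ : ℝ} {Q : ℝ → ℝ} (hQ : IsFeasible M 𝒞 fbar m Γ Q) :
    bias Q₀ Q L G₂ - bias Q₀ Q L G₁
      = (L G₁ - L G₂) - weightInner fbar Q (pairScore M fbar G₁ G₂) := by
  rw [← hP.integral_sub_integral h₁ h₂ hQ.tailConst hQ.integrable_sq (hQ.integrable _ h₁)
    (hQ.integrable _ h₂), bias, bias]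
  ring

/-- The multiple of the score of the extremal pair whose variance proxy is at most `s²`. -/
theorem isFeasible_mul_pairScore (hP : LocalProblem M κ c fbar 𝒞 L) {δ s : ℝ} (hδ : 0 < δ)
    (h₁ : G₁ ∈ 𝒞) (h₂ : G₂ ∈ 𝒞) (hχ : chiSqDist M fbar G₁ G₂ ≤ δ ^ 2) (m : ℕ) :
    IsFeasible M 𝒞 fbar m ((m : ℝ)⁻¹ * s ^ 2) fun u => s / δ * pairScore M fbar G₁ G₂ u := by
  have ht := (hP.tailConst_pairScore h₁ h₂).const_mul (s / δ)
  have hi := (hP.integrable_pairScore_sq h₁ h₂).const_mul ((s / δ) ^ 2)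
  have he : (fun u => (s / δ * pairScore M fbar G₁ G₂ u) ^ 2 * fbar u)
      = fun u => (s / δ) ^ 2 * (pairScore M fbar G₁ G₂ u ^ 2 * fbar u) := by
    ext u; ring
  refine ⟨ht.measurable, ht.left, ht.right, fun G hG => ?_, by rw [he]; exact hi, ?_⟩
  · have := hP.prob _ hG
    refine (Integrable.of_bound (C := (c + c) / κ)
      (hP.tailConst_pairScore h₁ h₂).measurable.aestronglyMeasurable
      (Eventually.of_forall fun u => ?_)).const_mul _
    exact hP.abs_pairScore_le h₁ h₂ u
  · rw [he, integral_const_mul, ← hP.chiSqDist_eq h₁ h₂, one_div]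
    gcongr
    calc (s / δ) ^ 2 * chiSqDist M fbar G₁ G₂ ≤ (s / δ) ^ 2 * δ ^ 2 := by gcongr
      _ = s ^ 2 := by field_simp

/-- The minimax weights are the multiple `s / δ` of the score of an extremal pair of the modulus
problem, `s` being a supergradient of the modulus at `δ`. Indeed, after centring, that multiple
has worst-case bias at most `(ω(δ) - s δ) / 2` by first-order optimality of the extremal pair, and
an equally small bias at the extremal pair forces equality in the Cauchy-Schwarz inequality. -/
theorem minimax_eq_pairScore (hP : LocalProblem M κ c fbar 𝒞 L) {δ s Q₀ : ℝ} {Q : ℝ → ℝ} {m : ℕ}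
    (hm : 0 < m) (hδ : 0 < δ) (hs : IsSupergradient (modulus M 𝒞 fbar L) δ s)
    (hmin : IsMinimax M 𝒞 fbar L m ((m : ℝ)⁻¹ * s ^ 2) Q₀ Q)
    (h₁ : G₁ ∈ 𝒞) (h₂ : G₂ ∈ 𝒞) (hχ : chiSqDist M fbar G₁ G₂ ≤ δ ^ 2)
    (hω : L G₁ - L G₂ = modulus M 𝒞 fbar L δ) :
    worstSqBias 𝒞 L Q₀ Q ≠ ⊤ ∧ (∀ᵐ u, Q u = s / δ * pairScore M fbar G₁ G₂ u)
      ∧ s * δ ≤ weightInner fbar Q (pairScore M fbar G₁ G₂) := by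
  obtain ⟨hfeas, hopt⟩ := hmin
  set S := pairScore M fbar G₁ G₂ with hS
  set ω := modulus M 𝒞 fbar L δ with hωdef
  have hfeas' := hP.isFeasible_mul_pairScore (s := s) hδ h₁ h₂ hχ m
  have hScale : ∀ R : ℝ → ℝ, weightInner fbar (fun u => s / δ * S u) R
      = s / δ * weightInner fbar S R := fun R => by
    rw [weightInner, weightInner, ← integral_const_mul]
    refine integral_congr_ae (Eventually.of_forall fun u => ?_)
    simp only
    ring
  obtain ⟨q, hq⟩ : ∃ q : ℝ, ∀ G ∈ 𝒞, |q + bias 0 (fun u => s / δ * S u) L G|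
      ≤ (ω - s * δ) / 2 := by
    refine exists_center ⟨G₁, h₁⟩ fun H₂ k₂ H₁ k₁ => ?_
    rw [hP.bias_sub_bias k₁ k₂ hfeas', hScale]
    have h := hP.sub_le_of_isSupergradient hδ hs h₁ h₂ hχ hω k₁ k₂
    have e : s / δ * (weightInner fbar S (pairScore M fbar H₁ H₂) - δ ^ 2)
        = s / δ * weightInner fbar S (pairScore M fbar H₁ H₂) - s * δ := by
      field_simp
    rw [e] at h
    linarith
  have hβ : 0 ≤ (ω - s * δ) / 2 := (abs_nonneg _).trans (hq G₁ h₁)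
  have hworst : worstSqBias 𝒞 L Q₀ Q ≤ ENNReal.ofReal (((ω - s * δ) / 2) ^ 2) := by
    refine (hopt q _ hfeas').trans (worstSqBias_le fun G hG => ?_)
    have : bias q (fun u => s / δ * S u) L G = q + bias 0 (fun u => s / δ * S u) L G := by
      simp only [bias]; ring
    rw [this]
    exact hq G hG
  have hfin : worstSqBias 𝒞 L Q₀ Q ≠ ⊤ := ne_top_of_le_ne_top ENNReal.ofReal_ne_top hworst
  have hB : worstBias 𝒞 L Q₀ Q ≤ (ω - s * δ) / 2 := by
    rw [worstBias]
    refine (Real.sqrt_le_sqrt (ENNReal.toReal_mono ENNReal.ofReal_ne_top hworst)).trans ?_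
    rw [ENNReal.toReal_ofReal (sq_nonneg _), Real.sqrt_sq hβ]
  have hinner : s * δ ≤ weightInner fbar Q S := by
    have e := hP.bias_sub_bias h₁ h₂ (Q₀ := Q₀) hfeas
    have b1 := (abs_le.1 (abs_bias_le_worstBias hfin h₁)).1
    have b2 := (abs_le.1 (abs_bias_le_worstBias hfin h₂)).2
    rw [hω] at e
    linarith
  refine ⟨hfin, ?_, hinner⟩
  have hm' : (0 : ℝ) < m := by exact_mod_cast hm
  have hQ2 : ∫ u, Q u ^ 2 * fbar u ≤ s ^ 2 := by
    have := hfeas.variance_le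
    rw [one_div] at this
    exact le_of_mul_le_mul_left this (inv_pos.2 hm')
  have hs0 := hP.nonneg_of_isSupergradient hδ hs ⟨G₁, h₁, G₂, h₂, hχ, hω⟩
  have hi1 := hP.integrable_mul_pairScore h₁ h₂ hfeas.measurable hfeas.integrable_sq
  have hi2 := hP.integrable_pairScore_sq h₁ h₂
  rw [← hS] at hi1 hi2
  have he : (fun u => (Q u - s / δ * S u) ^ 2 * fbar u)
      = fun u => Q u ^ 2 * fbar u - 2 * (s / δ) * (Q u * S u * fbar u)
        + (s / δ) ^ 2 * (S u ^ 2 * fbar u) := by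
    ext u; ring
  have hi : Integrable fun u => (Q u - s / δ * S u) ^ 2 * fbar u := by
    rw [he]
    exact (hfeas.integrable_sq.sub (hi1.const_mul _)).add (hi2.const_mul _)
  have hzero : ∫ u, (Q u - s / δ * S u) ^ 2 * fbar u ≤ 0 := by
    rw [he, integral_sub_mul_add_mul hfeas.integrable_sq hi1 hi2, ← hP.chiSqDist_eq h₁ h₂]
    have e1 : (s / δ) ^ 2 * chiSqDist M fbar G₁ G₂ ≤ s ^ 2 := by
      calc (s / δ) ^ 2 * chiSqDist M fbar G₁ G₂ ≤ (s / δ) ^ 2 * δ ^ 2 := by gcongr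
        _ = s ^ 2 := by field_simp
    have e2 : 2 * s ^ 2 ≤ 2 * (s / δ) * ∫ u, Q u * S u * fbar u := by
      calc 2 * s ^ 2 = 2 * (s / δ) * (s * δ) := by field_simp
        _ ≤ 2 * (s / δ) * weightInner fbar Q S := by gcongr
    linarith
  have hae := ae_eq_zero_of_integral_mul_pilot hP.pos hP.pilot
    (hfeas.tailConst.sub ((hP.tailConst_pairScore h₁ h₂).const_mul (s / δ))).sq
    (fun u => sq_nonneg _) hi hzero
  filter_upwards [hae] with u hu
  exact sub_eq_zero.1 (pow_eq_zero_iff two_ne_zero |>.1 hu)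

/-- If the localization is tight, then the standard deviation of weights that are a multiple of a
score is comparable to their variance proxy. -/
theorem le_two_mul_sqrt_variance (hP : LocalProblem M κ c fbar 𝒞 L) (hcκ : c ≤ κ / 4)
    {a s : ℝ} {Q : ℝ → ℝ} (hQ : TailConst M Q) (h₁ : G₁ ∈ 𝒞) (h₂ : G₂ ∈ 𝒞)
    (hQS : ∀ᵐ u, Q u = a * pairScore M fbar G₁ G₂ u)
    (hs : s ^ 2 = ∫ u, Q u ^ 2 * fbar u) {G : Measure ℝ} (hG : G ∈ 𝒞) :
    s ≤ 2 * √(Var[Q; sampleLaw G]) := by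
  have := hP.prob _ hG
  have hκ := hP.pilot.pos
  have hf := hP.pilot.integrable
  have hnear := hP.near _ hG
  have hc : 0 ≤ c := (abs_nonneg _).trans hnear.left
  have hr : c / κ ≤ 1 / 4 := by rw [div_le_iff₀ hκ]; linarith
  have hgi := (hP.integrable_density hG).sub hf
  have hgi' : Integrable fun u => marginalDensity G u - fbar u := hgi
  have hb : ∀ᵐ u, |Q u| ≤ |a| * ((c + c) / κ) := by
    filter_upwards [hQS] with u hu
    rw [hu, abs_mul]
    gcongr
    exact hP.abs_pairScore_le h₁ h₂ u
  set K := |a| * ((c + c) / κ)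
  have hbdd : ∀ {R g : ℝ → ℝ} {C : ℝ}, Measurable R → (∀ᵐ u, |R u| ≤ C) → Integrable g →
      Integrable fun u => R u * g u := fun hR hRC hg =>
    hg.bdd_mul hR.aestronglyMeasurable hRC
  have hb2 : ∀ᵐ u, |Q u ^ 2| ≤ K ^ 2 := by
    filter_upwards [hb] with u hu
    rw [abs_pow]; gcongr
  have hba : ∀ᵐ u, |(|Q u|)| ≤ K := by simpa using hb
  have hQm := hQ.measurable
  have hone : TailConst M fun _ => (1 : ℝ) := ⟨measurable_const, fun _ _ => rfl, fun _ _ => rfl⟩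
  -- The pilot has total mass at most `4 / 3`.
  have hmass : ∫ u, fbar u ≤ 4 / 3 ∧ 0 < ∫ u, fbar u := by
    have h := abs_integral_mul_sub_le hP.pos hP.pilot hnear hone (by simpa using hgi')
      (by simpa using hf)
    simp only [one_mul, abs_one] at h
    rw [integral_sub (hP.integrable_density hG) hf, integral_marginalDensity] at h
    have h0 := integral_mul_pilot_nonneg hP.pos hP.pilot hone (fun _ => zero_le_one)
      (by simpa using hf)
    simp only [one_mul] at h0
    have h3 : c / κ * ∫ u, fbar u ≤ 1 / 4 * ∫ u, fbar u := by gcongr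
    obtain ⟨h1, h2⟩ := abs_le.1 h
    constructor <;> linarith
  -- The mean of the weights under the pilot vanishes.
  have hmean0 : ∫ u, Q u * fbar u = 0 := by
    have hsc := hP.tailConst_pairScore h₁ h₂
    have hsi : Integrable fun u => 1 * pairScore M fbar G₁ G₂ u * fbar u := by
      simp only [one_mul]
      exact hbdd hsc.measurable (Eventually.of_forall (hP.abs_pairScore_le h₁ h₂)) hf
    have h := integral_mul_score hP.pos hP.pilot (hP.measurable_diff h₁ h₂) hone
      (by simpa using hP.integrable_diff h₁ h₂) hsi
    have := hP.prob _ h₁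
    have := hP.prob _ h₂
    simp only [one_mul] at h
    rw [integral_sub (hP.integrable_density h₁) (hP.integrable_density h₂),
      integral_marginalDensity, integral_marginalDensity, sub_self] at h
    calc ∫ u, Q u * fbar u = ∫ u, a * (pairScore M fbar G₁ G₂ u * fbar u) := by
          refine integral_congr_ae ?_
          filter_upwards [hQS] with u hu
          rw [hu]; ring
      _ = 0 := by rw [integral_const_mul, pairScore, h, mul_zero]
  have hQf := hbdd hQm hb hf
  have hQ2f := hbdd (hQm.pow_const 2) hb2 hf
  have hQaf := hbdd hQm.abs hba hf
  -- Cauchy-Schwarz for the positive functional given by the pilot.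
  have hCS : (∫ u, |Q u| * fbar u) ^ 2 ≤ 4 / 3 * s ^ 2 := by
    set I := ∫ u, |Q u| * fbar u
    set p := ∫ u, fbar u with hp
    have hct : TailConst M fun _ : ℝ => I / p :=
      ⟨measurable_const, fun _ _ => rfl, fun _ _ => rfl⟩
    have he : (fun u => (|Q u| - I / p) ^ 2 * fbar u) = fun u => Q u ^ 2 * fbar u
        - 2 * (I / p) * (|Q u| * fbar u) + (I / p) ^ 2 * fbar u := by
      ext u
      rw [← sq_abs (Q u)]
      ring
    have hi : Integrable fun u => (|Q u| - I / p) ^ 2 * fbar u := by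
      rw [he]
      exact (hQ2f.sub (hQaf.const_mul _)).add (hf.const_mul _)
    have h := integral_mul_pilot_nonneg hP.pos hP.pilot (hQ.abs.sub hct).sq
      (fun u => sq_nonneg _) hi
    rw [he, integral_sub_mul_add_mul hQ2f hQaf hf, ← hs, ← hp] at h
    have hp0 := hmass.2
    have h' : I ^ 2 / p ≤ s ^ 2 := by
      have : 2 * (I / p) * I - (I / p) ^ 2 * p = I ^ 2 / p := by field_simp; ring
      linarith
    rw [div_le_iff₀ hp0] at h'
    nlinarith [hmass.1, sq_nonneg s]
  have hmean : (∫ u, Q u ∂(sampleLaw G)) ^ 2 ≤ s ^ 2 / 12 := by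
    have hQg := hbdd hQm hb hgi'
    have h := abs_integral_mul_sub_le hP.pos hP.pilot hnear hQ hQg hQf
    have e : ∫ u, Q u ∂(sampleLaw G) = ∫ u, Q u * (marginalDensity G u - fbar u) := by
      simp_rw [mul_sub]
      rw [integral_sampleLaw, integral_sub (hbdd hQm hb (hP.integrable_density hG)) hQf, hmean0,
        sub_zero]
    have h2 : |∫ u, Q u ∂(sampleLaw G)| ≤ 1 / 4 * ∫ u, |Q u| * fbar u := by
      rw [e]
      refine h.trans ?_
      have := integral_mul_pilot_nonneg hP.pos hP.pilot hQ.abs (fun u => abs_nonneg _) hQaf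
      gcongr
    rw [← sq_abs]
    calc |∫ u, Q u ∂(sampleLaw G)| ^ 2 ≤ (1 / 4 * ∫ u, |Q u| * fbar u) ^ 2 := by gcongr
      _ ≤ s ^ 2 / 12 := by rw [mul_pow]; linarith
  have hsecond : 3 / 4 * s ^ 2 ≤ ∫ u, Q u ^ 2 ∂(sampleLaw G) := by
    have h := abs_integral_mul_sub_le hP.pos hP.pilot hnear hQ.sq
      (hbdd (hQm.pow_const 2) hb2 hgi') hQ2f
    simp only [abs_pow, sq_abs] at h
    rw [← hs] at h
    simp_rw [mul_sub] at h
    rw [integral_sub (hbdd (hQm.pow_const 2) hb2 (hP.integrable_density hG)) hQ2f, ← hs] at h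
    rw [integral_sampleLaw]
    have h3 : c / κ * s ^ 2 ≤ 1 / 4 * s ^ 2 := by gcongr
    linarith [(abs_le.1 h).1]
  have hL2 : MemLp Q 2 (sampleLaw G) :=
    MemLp.of_bound hQm.aestronglyMeasurable K ((sampleLaw_absolutelyContinuous G).ae_le hb)
  have hvar : Var[Q; sampleLaw G]
      = (∫ u, Q u ^ 2 ∂(sampleLaw G)) - (∫ u, Q u ∂(sampleLaw G)) ^ 2 := by
    rw [variance_eq_sub hL2]; rfl
  have hfin : (s / 2) ^ 2 ≤ Var[Q; sampleLaw G] := by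
    rw [hvar]; nlinarith [sq_nonneg s]
  have := Real.le_sqrt_of_sq_le hfin
  linarith

/-- What the minimax construction provides for inference: a valid bound on the bias, weights that
are small relative to their standard deviation, and a lower bound on the total error. -/
theorem minimax_bounds (hP : LocalProblem M κ c fbar 𝒞 L) (hcκ : c ≤ κ / 4) {δ s Q₀ : ℝ}
    {Q : ℝ → ℝ} {m : ℕ} (hm : 0 < m) (hδ : 0 < δ)
    (hs : IsSupergradient (modulus M 𝒞 fbar L) δ s)
    (hatt : ModulusAttained M 𝒞 fbar L δ)
    (hmin : IsMinimax M 𝒞 fbar L m ((m : ℝ)⁻¹ * s ^ 2) Q₀ Q) {G : Measure ℝ} (hG : G ∈ 𝒞) :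
    |bias Q₀ Q L G| ≤ worstBias 𝒞 L Q₀ Q
      ∧ (∀ᵐ u, |Q u| ≤ 4 * c / (κ * δ) * √(Var[Q; sampleLaw G]))
      ∧ ∀ t : ℝ, 0 < t → modulus M 𝒞 fbar L t
          ≤ 2 * worstBias 𝒞 L Q₀ Q + 2 * √(Var[Q; sampleLaw G]) * t := by
  have hs0 := hP.nonneg_of_isSupergradient hδ hs hatt
  obtain ⟨G₁, h₁, G₂, h₂, hχ, hω⟩ := hatt
  obtain ⟨hfin, hQS, hinner⟩ := hP.minimax_eq_pairScore hm hδ hs hmin h₁ h₂ hχ hω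
  have hκ := hP.pilot.pos
  have hc : 0 ≤ c := (abs_nonneg _).trans (hP.near _ hG).left
  have hfeas := hmin.1
  have hχeq := hP.chiSqDist_eq h₁ h₂
  have e1 : weightInner fbar Q (pairScore M fbar G₁ G₂) = s / δ * chiSqDist M fbar G₁ G₂ := by
    rw [hχeq, weightInner, ← integral_const_mul]
    refine integral_congr_ae ?_
    filter_upwards [hQS] with u hu
    rw [hu]; ring
  have e2 : ∫ u, Q u ^ 2 * fbar u = s / δ * (s / δ * chiSqDist M fbar G₁ G₂) := by
    rw [hχeq, ← integral_const_mul, ← integral_const_mul]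
    refine integral_congr_ae ?_
    filter_upwards [hQS] with u hu
    rw [hu]; ring
  have hle : s / δ * chiSqDist M fbar G₁ G₂ ≤ s * δ := by
    calc s / δ * chiSqDist M fbar G₁ G₂ ≤ s / δ * δ ^ 2 := by gcongr
      _ = s * δ := by field_simp
  have heq : s / δ * chiSqDist M fbar G₁ G₂ = s * δ := le_antisymm hle (e1 ▸ hinner)
  have hs2 : s ^ 2 = ∫ u, Q u ^ 2 * fbar u := by
    rw [e2, heq]; field_simp
  have hσ := hP.le_two_mul_sqrt_variance hcκ hfeas.tailConst h₁ h₂ hQS hs2 hG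
  refine ⟨abs_bias_le_worstBias hfin hG, ?_, fun t ht => ?_⟩
  · filter_upwards [hQS] with u hu
    rw [hu, abs_mul, abs_of_nonneg (by positivity : 0 ≤ s / δ)]
    calc s / δ * |pairScore M fbar G₁ G₂ u|
        ≤ (2 * √(Var[Q; sampleLaw G])) / δ * ((c + c) / κ) := by
          gcongr
          exact hP.abs_pairScore_le h₁ h₂ u
      _ = _ := by field_simp; ring
  · have h := hs t ht
    have e := hP.bias_sub_bias h₁ h₂ (Q₀ := Q₀) hfeas
    have b1 := (abs_le.1 (abs_bias_le_worstBias hfin h₁)).1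
    have b2 := (abs_le.1 (abs_bias_le_worstBias hfin h₂)).2
    rw [hω, e1, heq] at e
    have : s * t ≤ 2 * √(Var[Q; sampleLaw G]) * t := by gcongr
    linarith

end LocalProblem

/-! ### Events of probability tending to one -/

section HighProb

variable {G : Measure ℝ} [IsProbabilityMeasure G] {E F : ∀ m : ℕ, (Fin m → ℝ) → Prop}

instance isProbabilityMeasure_foldLaw (m : ℕ) : IsProbabilityMeasure (foldLaw G m) := by
  unfold foldLaw; infer_instance

instance isProbabilityMeasure_twoFoldLaw (m : ℕ) : IsProbabilityMeasure (twoFoldLaw G m) := by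
  unfold twoFoldLaw; infer_instance

theorem withHighProb_iff :
    WithHighProb G E ↔ Tendsto (fun m => foldLaw G m {xt | ¬ E m xt}) atTop (𝓝 0) := by
  have hE : ∀ m, prob (foldLaw G m) {xt | E m xt} = 1 - foldLaw G m {xt | ¬ E m xt} :=
    fun m => rfl
  constructor
  · intro h
    have h' := ENNReal.Tendsto.sub (tendsto_const_nhds (x := (1 : ℝ≥0∞))) h
      (Or.inl ENNReal.one_ne_top)
    rw [tsub_self] at h'
    refine h'.congr fun m => ?_
    rw [hE, ENNReal.sub_sub_cancel ENNReal.one_ne_top prob_le_one]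
  · intro h
    have h' := ENNReal.Tendsto.sub (tendsto_const_nhds (x := (1 : ℝ≥0∞))) h
      (Or.inl ENNReal.one_ne_top)
    rw [tsub_zero] at h'
    exact h'

theorem WithHighProb.and (hE : WithHighProb G E) (hF : WithHighProb G F) :
    WithHighProb G fun m xt => E m xt ∧ F m xt := by
  rw [withHighProb_iff] at *
  have h := hE.add hF
  rw [add_zero] at h
  refine tendsto_of_tendsto_of_tendsto_of_le_of_le tendsto_const_nhds h (fun m => zero_le)
    fun m => ?_
  refine le_trans (measure_mono ?_) (measure_union_le _ _)
  intro xt hxt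
  simp only [Set.mem_union, Set.mem_ofPred_eq] at hxt ⊢
  tauto

theorem WithHighProb.mono (hE : WithHighProb G E)
    (h : ∀ᶠ m in atTop, ∀ xt : Fin m → ℝ, E m xt → F m xt) : WithHighProb G F := by
  rw [withHighProb_iff] at *
  refine tendsto_of_tendsto_of_tendsto_of_le_of_le' tendsto_const_nhds hE
    (Eventually.of_forall fun m => zero_le) ?_
  filter_upwards [h] with m hm
  exact measure_mono fun xt hxt hE => hxt (hm xt hE)

end HighProb

/-! ### The error of linearization -/

/-- Linearizing the ratio `A / F` at pilots close to `A` and `F` costs a second-order term. -/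
theorem abs_linearization_le {A F Abar Fbar : ℝ} (hF : 0 < F) (hFbar : |F - Fbar| ≤ F / 2)
    (hAbar : |A - Abar| ≤ 1) :
    |A / F - Abar / Fbar - (A - Abar / Fbar * F) / Fbar|
      ≤ (2 / F ^ 2 + 4 * (|A| + 1) / F ^ 3) * (|A - Abar| * |F - Fbar| + |F - Fbar| ^ 2) := by
  have hl : F / 2 ≤ Fbar := by linarith [(abs_le.1 hFbar).2]
  have hFb : 0 < Fbar := by linarith
  have hA : |Abar| ≤ |A| + 1 := by
    have := abs_sub_abs_le_abs_sub Abar A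
    rw [abs_sub_comm] at this
    linarith
  have e : A / F - Abar / Fbar - (A - Abar / Fbar * F) / Fbar
      = -((A - Abar) * (F - Fbar)) / (F * Fbar) + Abar * (F - Fbar) ^ 2 / (F * Fbar ^ 2) := by
    field_simp
    ring
  have h1 : |-((A - Abar) * (F - Fbar)) / (F * Fbar)|
      ≤ 2 / F ^ 2 * (|A - Abar| * |F - Fbar|) := by
    rw [abs_div, abs_neg, abs_mul, abs_of_pos (by positivity : 0 < F * Fbar)]
    calc |A - Abar| * |F - Fbar| / (F * Fbar) ≤ |A - Abar| * |F - Fbar| / (F * (F / 2)) := by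
          gcongr
      _ = _ := by field_simp
  have h2 : |Abar * (F - Fbar) ^ 2 / (F * Fbar ^ 2)|
      ≤ 4 * (|A| + 1) / F ^ 3 * |F - Fbar| ^ 2 := by
    rw [abs_div, abs_mul, abs_pow, abs_of_pos (by positivity : 0 < F * Fbar ^ 2)]
    calc |Abar| * |F - Fbar| ^ 2 / (F * Fbar ^ 2)
        ≤ (|A| + 1) * |F - Fbar| ^ 2 / (F * (F / 2) ^ 2) := by gcongr
      _ = _ := by field_simp; norm_num
  rw [e]
  refine (abs_add_le _ _).trans ((add_le_add h1 h2).trans ?_)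
  have p1 : 0 ≤ |A - Abar| * |F - Fbar| := by positivity
  have p2 : 0 ≤ |F - Fbar| ^ 2 := by positivity
  have c1 : 0 ≤ 2 / F ^ 2 := by positivity
  have c2 : 0 ≤ 4 * (|A| + 1) / F ^ 3 := by positivity
  nlinarith [mul_nonneg c1 p2, mul_nonneg c2 p1]

section Linearization

variable {G : Measure ℝ}

/-- Markov's inequality for a scaled squared error. -/
theorem meas_lt_mul_sq_le {m : ℕ} {T : (Fin m → ℝ) → ℝ} (hT : Measurable T) (a : ℝ) {k R : ℝ}
    (hk : 0 ≤ k) (hR : 0 < R) :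
    foldLaw G m {xt | R < k * (a - T xt) ^ 2}
      ≤ ENNReal.ofReal k * mse G m a T / ENNReal.ofReal R := by
  rw [mse, ← lintegral_const_mul _ (by fun_prop)]
  refine le_trans (measure_mono ?_) (meas_ge_le_lintegral_div
    (Measurable.aemeasurable (by fun_prop)) (ENNReal.ofReal_pos.2 hR).ne' ENNReal.ofReal_ne_top)
  intro xt hxt
  simp only [Set.mem_ofPred_eq] at hxt ⊢
  rw [← ENNReal.ofReal_mul hk]
  exact ENNReal.ofReal_le_ofReal hxt.le

theorem tendsto_sqrt_log_atTop : Tendsto (fun m : ℕ => √(Real.log m)) atTop atTop :=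
  Real.tendsto_sqrt_atTop.comp (Real.tendsto_log_atTop.comp tendsto_natCast_atTop_atTop)

theorem tendsto_sqrt_log_div_sqrt :
    Tendsto (fun m : ℕ => √(Real.log m) / √(m : ℝ)) atTop (𝓝 0) := by
  have h : Tendsto (fun x : ℝ => Real.log x / x) atTop (𝓝 0) := by
    have := Real.isLittleO_log_id_atTop.tendsto_div_nhds_zero
    simpa using this
  have h' := (Real.continuous_sqrt.tendsto 0).comp (h.comp tendsto_natCast_atTop_atTop)
  rw [Real.sqrt_zero] at h'
  refine h'.congr fun m => ?_
  simp [Real.sqrt_div']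

/-- Rates under which the linearization error is negligible at the parametric scale, in terms of
the rescaled squared errors of the two pilots. -/
theorem eventually_abs_linearization_le {A F : ℝ} (hF : 0 < F) {ε l : ℝ} (hε : 0 < ε)
    (hl : 0 < l) :
    ∃ R v : ℝ, R = ε / (2 / F ^ 2 + 4 * (|A| + 1) / F ^ 3) / (3 * l) ∧ 0 < v ∧
    ∀ᶠ m : ℕ in atTop, ∀ Abar Fbar : ℝ,
      (m : ℝ) / √(Real.log m) * (F - Fbar) ^ 2 ≤ R →
      √(Real.log m) * (A - Abar) ^ 2 ≤ v →
      |A / F - Abar / Fbar - (A - Abar / Fbar * F) / Fbar| ≤ ε / √(m : ℝ) := by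
  set K := 2 / F ^ 2 + 4 * (|A| + 1) / F ^ 3 with hK
  have hK0 : 0 < K := by positivity
  set ε' := ε / K with hε'
  have hε'0 : 0 < ε' := by positivity
  refine ⟨ε' / (3 * l), l * ε', rfl, by positivity, ?_⟩
  have hR0 : 0 < ε' / (3 * l) := by positivity
  have hsmall := tendsto_sqrt_log_div_sqrt
  filter_upwards [eventually_ge_atTop 2, tendsto_sqrt_log_atTop.eventually_ge_atTop (l * ε'),
    hsmall.eventually_le_const hl,
    hsmall.eventually_le_const (by positivity : 0 < (F / 2) ^ 2 / (ε' / (3 * l)))]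
    with m hm hv1 hv2 hv3 Abar Fbar hU hV
  have hm' : (2 : ℝ) ≤ m := by exact_mod_cast hm
  have hmpos : (0 : ℝ) < m := by linarith
  have hs : 0 < √(m : ℝ) := Real.sqrt_pos.2 hmpos
  have hs1 : 1 ≤ √(m : ℝ) := by rw [Real.one_le_sqrt]; linarith
  have hs2 : √(m : ℝ) ^ 2 = m := Real.sq_sqrt hmpos.le
  have hL : 0 < √(Real.log m) := Real.sqrt_pos.2 (Real.log_pos (by linarith))
  set s := √(m : ℝ)
  set q := √(Real.log m)
  set dF := F - Fbar
  set dA := A - Abar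
  have hU0 : 0 ≤ (m : ℝ) / q * dF ^ 2 := by positivity
  have hdF2 : dF ^ 2 = q / s * ((m : ℝ) / q * dF ^ 2) / s := by
    rw [← hs2]; field_simp
  have h1 : |dF| ≤ F / 2 := by
    refine abs_le_of_sq_le_sq ?_ (by positivity)
    rw [hdF2]
    calc q / s * ((m : ℝ) / q * dF ^ 2) / s
        ≤ (F / 2) ^ 2 / (ε' / (3 * l)) * (ε' / (3 * l)) / 1 := by gcongr
      _ = (F / 2) ^ 2 := by field_simp
  have h2 : |dA| ≤ 1 := by
    refine abs_le_of_sq_le_sq ?_ zero_le_one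
    rw [one_pow]
    have : q * dA ^ 2 ≤ q * 1 := by linarith
    exact le_of_mul_le_mul_left this hL
  have h3 := abs_linearization_le hF h1 h2
  rw [← hK] at h3
  refine h3.trans ?_
  -- The cross term is split by the arithmetic-geometric mean inequality with weight `l`.
  have h4 : s * (|dA| * |dF| + |dF| ^ 2) ≤ ε' := by
    have e1 : s * |dF| ^ 2 ≤ l * ((m : ℝ) / q * dF ^ 2) := by
      have : s * |dF| ^ 2 = q / s * ((m : ℝ) / q * dF ^ 2) := by
        rw [sq_abs, ← hs2]; field_simp
      rw [this]
      gcongr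
    have e2 : 2 * (s * (|dA| * |dF|)) ≤ l * ((m : ℝ) / q * dF ^ 2) + q * dA ^ 2 / l := by
      have h5 : l * ((m : ℝ) / q * dF ^ 2) + q * dA ^ 2 / l - 2 * (s * (|dA| * |dF|))
          = (l * s * |dF| - q * |dA|) ^ 2 / (l * q) := by
        rw [← hs2, ← sq_abs dF, ← sq_abs dA]
        field_simp
        ring
      have : 0 ≤ (l * s * |dF| - q * |dA|) ^ 2 / (l * q) := by positivity
      linarith
    have e3 : l * ((m : ℝ) / q * dF ^ 2) ≤ ε' / 3 := by
      calc l * ((m : ℝ) / q * dF ^ 2) ≤ l * (ε' / (3 * l)) := by gcongr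
        _ = ε' / 3 := by field_simp
    have e4 : q * dA ^ 2 / l ≤ ε' := by rw [div_le_iff₀ hl]; linarith
    linarith
  rw [le_div_iff₀ hs]
  calc K * (|dA| * |dF| + |dF| ^ 2) * s = K * (s * (|dA| * |dF| + |dF| ^ 2)) := by ring
    _ ≤ K * ε' := by gcongr
    _ = ε := by rw [hε']; field_simp

/-- With high probability the linearization error is negligible at the parametric scale. -/
theorem withHighProb_linearization [IsProbabilityMeasure G] {A F : ℝ} (hF : 0 < F)
    {Abar Fbar : ∀ m : ℕ, (Fin m → ℝ) → ℝ} (hAm : ∀ m, Measurable (Abar m))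
    (hFm : ∀ m, Measurable (Fbar m))
    (rate_F : limsup (fun m : ℕ => ENNReal.ofReal ((m : ℝ) / √(Real.log m))
      * mse G m F (Fbar m)) atTop < ⊤)
    (rate_A : limsup (fun m : ℕ => ENNReal.ofReal (√(Real.log m))
      * mse G m A (Abar m)) atTop = 0) {ε : ℝ} (hε : 0 < ε) :
    WithHighProb G fun m xt =>
      |A / F - Abar m xt / Fbar m xt - (A - Abar m xt / Fbar m xt * F) / Fbar m xt|
        ≤ ε / √(m : ℝ) := by
  rw [withHighProb_iff, ENNReal.tendsto_nhds_zero]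
  intro ζ hζ
  obtain ⟨z, hz0, hzζ⟩ : ∃ z : ℝ, 0 < z ∧ ENNReal.ofReal z ≤ ζ := by
    obtain ⟨y, hy0, hyζ⟩ := ENNReal.lt_iff_exists_nnreal_btwn.1 hζ
    exact ⟨y, by simpa using hy0, by rw [ENNReal.ofReal_coe_nnreal]; exact hyζ.le⟩
  obtain ⟨B, hB0, hB⟩ : ∃ B : ℝ, 0 < B ∧ ∀ᶠ m : ℕ in atTop,
      ENNReal.ofReal ((m : ℝ) / √(Real.log m)) * mse G m F (Fbar m) ≤ ENNReal.ofReal B := by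
    obtain ⟨y, hy, -⟩ := ENNReal.lt_iff_exists_nnreal_btwn.1 rate_F
    refine ⟨y + 1, by positivity, ?_⟩
    filter_upwards [eventually_lt_of_limsup_lt hy] with m hm
    refine hm.le.trans ?_
    rw [← ENNReal.ofReal_coe_nnreal]
    exact ENNReal.ofReal_le_ofReal (by linarith)
  set K := 2 / F ^ 2 + 4 * (|A| + 1) / F ^ 3 with hK
  have hK0 : 0 < K := by positivity
  -- The weight `l` is chosen so that Markov's inequality at level `R` gives `B / R = z / 2`.
  set l := z * (ε / K) / (6 * B) with hl
  have hl0 : 0 < l := by positivity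
  obtain ⟨R, v, hR, hv, hev⟩ := eventually_abs_linearization_le (A := A) hF hε hl0
  have hR0 : 0 < R := by rw [hR]; positivity
  have hBR : B / R = z / 2 := by
    rw [hR, ← hK, hl]; field_simp; norm_num
  have hA' : ∀ᶠ m : ℕ in atTop,
      ENNReal.ofReal (√(Real.log m)) * mse G m A (Abar m) < ENNReal.ofReal (v * (z / 2)) :=
    eventually_lt_of_limsup_lt (by rw [rate_A]; exact ENNReal.ofReal_pos.2 (by positivity))
  filter_upwards [hev, hB, hA'] with m hm hBm hAm'
  refine le_trans ?_ hzζ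
  calc foldLaw G m _ ≤ foldLaw G m ({xt | R < (m : ℝ) / √(Real.log m) * (F - Fbar m xt) ^ 2}
        ∪ {xt | v < √(Real.log m) * (A - Abar m xt) ^ 2}) := by
        refine measure_mono ?_
        intro xt hxt
        by_contra hcon
        simp only [Set.mem_union, Set.mem_ofPred_eq, not_or, not_lt] at hcon hxt
        exact hxt (hm _ _ hcon.1 hcon.2)
    _ ≤ ENNReal.ofReal B / ENNReal.ofReal R + ENNReal.ofReal (v * (z / 2)) / ENNReal.ofReal v := by
        refine (measure_union_le _ _).trans (add_le_add ?_ ?_)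
        · refine (meas_lt_mul_sq_le (hFm m) F (by positivity) hR0).trans ?_
          gcongr
        · refine (meas_lt_mul_sq_le (hAm m) A (by positivity) hv).trans ?_
          gcongr
    _ = ENNReal.ofReal z := by
        rw [← ENNReal.ofReal_div_of_pos hR0, ← ENNReal.ofReal_div_of_pos hv, hBR,
          mul_div_cancel_left₀ _ hv.ne', ← ENNReal.ofReal_add (by positivity) (by positivity)]
        congr 1
        ring

end Linearization

/-! ### Coverage -/

/-- The localized class, with the linearized target, satisfies the conditions of the local problem
once the pilot density is close to the true one. -/
theorem localProblem_localization {𝒢 : Set (Measure ℝ)}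
    (h_prob : ∀ G' ∈ 𝒢, IsProbabilityMeasure G') (h_convex : Convex ℝ≥0 𝒢)
    {G : Measure ℝ} [IsProbabilityMeasure G] {h : ℝ → ℝ} {x : ℝ}
    (h_int : ∀ G' ∈ 𝒢, Integrable (fun μ => h μ * gaussianPDFReal 0 1 (x - μ)) G')
    {M κ c Abar Fbar : ℝ} (hM : 0 < M) (hκ : 0 < κ)
    (hmid : ∀ u ∈ Set.Icc (-M) M, κ ≤ marginalDensity G u)
    (hleft : κ ≤ ∫ u in Set.Iic (-M), marginalDensity G u)
    (hright : κ ≤ ∫ u in Set.Ici M, marginalDensity G u)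
    {fbar : ℝ → ℝ} (hfm : Measurable fbar) (hfi : Integrable fbar)
    (hc0 : 0 ≤ c) (hc : c ≤ κ / 8)
    (hnear : Near M c fun u => marginalDensity G u - fbar u)
    {K : ℝ} (hK : ∀ G' ∈ 𝒢, |calibrationTarget h x Abar Fbar G'| ≤ K) :
    LocalProblem M (κ / 2) c fbar (localization M 𝒢 fbar c) (calibrationTarget h x Abar Fbar) := by
  have hnear' : ∀ G' ∈ localization M 𝒢 fbar c,
      Near M c fun u => marginalDensity G' u - fbar u := fun G' hG' =>
    (supTailNorm_le_iff hc0).1 hG'.2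
  have hGi := integrable_marginalDensity G
  have hi : ∀ s : Set ℝ, ∫ u in s, (marginalDensity G u - fbar u)
      = (∫ u in s, marginalDensity G u) - ∫ u in s, fbar u := fun s =>
    integral_sub hGi.integrableOn hfi.integrableOn
  refine ⟨hM, ⟨hfm, hfi, by positivity, fun u hu => ?_, ?_, ?_⟩, fun G' hG' => h_prob G' hG'.1,
    hnear', fun G₁ h₁ G₂ h₂ a b hab => ⟨h_convex h₁.1 h₂.1 zero_le zero_le hab, ?_⟩,
    fun G₁ h₁ G₂ h₂ a b => ?_, ⟨K, fun G' hG' => hK G' hG'.1⟩⟩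
  · linarith [(abs_le.1 (hnear.mid u hu)).2, hmid u hu]
  · have := hnear.left
    rw [hi] at this
    linarith [(abs_le.1 this).2]
  · have := hnear.right
    rw [hi] at this
    linarith [(abs_le.1 this).2]
  · have := h_prob _ h₁.1
    have := h_prob _ h₂.1
    rw [supTailNorm_le_iff hc0]
    have hab' : (a : ℝ) + b = 1 := by exact_mod_cast hab
    have hmix := (hnear' _ h₁).mixture (hnear' _ h₂)
      ((integrable_marginalDensity G₁).sub hfi) ((integrable_marginalDensity G₂).sub hfi)
      a.2 b.2 hab'
    have e : (fun u => marginalDensity (a • G₁ + b • G₂) u - fbar u)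
        = fun u => (a : ℝ) * (marginalDensity G₁ u - fbar u)
          + b * (marginalDensity G₂ u - fbar u) := by
      ext u
      rw [marginalDensity_mixture]
      linear_combination fbar u * hab'
    rw [e]
    exact hmix
  · have := h_prob _ h₁.1
    have := h_prob _ h₂.1
    exact calibrationTarget_mixture a b Abar Fbar (h_int _ h₁.1) (h_int _ h₂.1)

/-- Membership in the inflated interval, in terms of the bias, the noise and the error of
linearization. -/
theorem mem_inflatedInterval {α η : ℝ} {𝒢m : Set (Measure ℝ)} {h : ℝ → ℝ} {x Abar Fbar Q₀ : ℝ}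
    {Q : ℝ → ℝ} {m : ℕ} {X : Fin m → ℝ} {G : Measure ℝ} {q : ℝ}
    (hnoise : |bias Q₀ Q (calibrationTarget h x Abar Fbar) G
      + ((1 / (m : ℝ)) * ∑ i, Q (X i) - ∫ u, Q u ∂(sampleLaw G))| ≤ q)
    (hq : q + |posteriorExpectation h x G - Abar / Fbar - calibrationTarget h x Abar Fbar G|
      ≤ (1 + η) * halfWidth α (worstBias 𝒢m (calibrationTarget h x Abar Fbar) Q₀ Q)
        (varianceEstimate Q X)) :
    posteriorExpectation h x G ∈ inflatedInterval α η 𝒢m h x Abar Fbar Q₀ Q X := by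
  simp only [inflatedInterval, linearEstimate, Set.mem_Icc]
  rw [bias] at hnoise
  obtain ⟨h1, h2⟩ := abs_le.1 hnoise
  obtain ⟨h3, h4⟩ := abs_le.1 (le_refl
    |posteriorExpectation h x G - Abar / Fbar - calibrationTarget h x Abar Fbar G|)
  constructor <;> linarith

/-- The second fold is used only through a measurable event. If, off a set of first folds of small
probability, the interval covers outside an event whose conditional probability given the first fold
is at most `p`, then the coverage probability is at least about `1 - p`. -/
theorem le_prob_twoFoldLaw {G : Measure ℝ} [IsProbabilityMeasure G] {m : ℕ}
    {good : (Fin m → ℝ) → Prop} {cover : Set ((Fin m → ℝ) × (Fin m → ℝ))}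
    {bad : Set ((Fin m → ℝ) × (Fin m → ℝ))} (hbad : MeasurableSet bad) {p q : ℝ≥0∞}
    (hq : foldLaw G m {xt | ¬ good xt} ≤ q)
    (hp : ∀ xt, good xt → foldLaw G m {X | (xt, X) ∈ bad} ≤ p)
    (hcover : ∀ xt X, good xt → (xt, X) ∉ bad → (xt, X) ∈ cover) :
    1 - (q + p) ≤ prob (twoFoldLaw G m) cover := by
  rw [prob]
  refine tsub_le_tsub_left ?_ 1
  set N := toMeasurable (foldLaw G m) {xt | ¬ good xt} with hN
  have hNm : MeasurableSet N := measurableSet_toMeasurable _ _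
  have hgood : ∀ xt, xt ∉ N → good xt := fun xt hxt => by
    by_contra hcon
    exact hxt (subset_toMeasurable _ _ hcon)
  have hsub : coverᶜ ⊆ N ×ˢ Set.univ ∪ (Nᶜ ×ˢ Set.univ ∩ bad) := by
    rintro ⟨xt, X⟩ hX
    by_cases hxt : xt ∈ N
    · exact Or.inl ⟨hxt, Set.mem_univ _⟩
    · refine Or.inr ⟨⟨hxt, Set.mem_univ _⟩, ?_⟩
      by_contra hcon
      exact hX (hcover xt X (hgood xt hxt) hcon)
  have hbad' : MeasurableSet (Nᶜ ×ˢ (Set.univ : Set (Fin m → ℝ)) ∩ bad) :=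
    (hNm.compl.prod MeasurableSet.univ).inter hbad
  refine (measure_mono hsub).trans ((measure_union_le _ _).trans (add_le_add ?_ ?_))
  · rw [twoFoldLaw, Measure.prod_prod, measure_univ, mul_one, hN, measure_toMeasurable]
    exact hq
  · rw [twoFoldLaw, Measure.prod_apply hbad']
    calc ∫⁻ xt, foldLaw G m (Prod.mk xt ⁻¹' (Nᶜ ×ˢ Set.univ ∩ bad)) ∂(foldLaw G m)
        ≤ ∫⁻ _, p ∂(foldLaw G m) := by
          refine lintegral_mono fun xt => ?_
          by_cases hxt : xt ∈ N
          · have : Prod.mk xt ⁻¹' (Nᶜ ×ˢ (Set.univ : Set (Fin m → ℝ)) ∩ bad) = ∅ := by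
              ext X; simp [hxt]
            rw [this, measure_empty]
            exact zero_le
          · refine (measure_mono ?_).trans (hp xt (hgood xt hxt))
            exact fun X hX => hX.2
      _ = p := by rw [lintegral_const, measure_univ, mul_one]

section Measurability

variable {P : Measure ℝ} [IsProbabilityMeasure P] {Ω : Type*} [MeasurableSpace Ω]
  {Q : Ω → ℝ → ℝ}

theorem measurable_integral_weight (hQ : Measurable (Function.uncurry Q)) :
    Measurable fun ω => ∫ u, Q ω u ∂P :=
  (hQ.stronglyMeasurable.integral_prod_right (ν := P)).measurable

theorem measurable_variance_weight (hQ : Measurable (Function.uncurry Q)) :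
    Measurable fun ω => Var[Q ω; P] := by
  have h : ∀ ω, Var[Q ω; P] = ∫ u, (Q ω u - ∫ v, Q ω v ∂P) ^ 2 ∂P := fun ω =>
    variance_eq_integral (hQ.comp (measurable_const.prodMk measurable_id)).aemeasurable
  simp_rw [h]
  refine measurable_integral_weight ?_
  exact (hQ.sub ((measurable_integral_weight hQ).comp measurable_fst)).pow_const 2

end Measurability

/-- The event, determined by both folds, that the noise exceeds its conditional quantile or that the
variance estimate is inaccurate. -/
def noiseEvent (P : Measure ℝ) (α ρ : ℝ) {m : ℕ} (b : (Fin m → ℝ) → ℝ) (Q : (Fin m → ℝ) → ℝ → ℝ) :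
    Set ((Fin m → ℝ) × (Fin m → ℝ)) :=
  {p | tailQuantile α (b p.1) (√(Var[Q p.1; P]) / √(m : ℝ))
        < |b p.1 + ((1 / (m : ℝ)) * ∑ i, Q p.1 (p.2 i) - ∫ u, Q p.1 u ∂P)|}
    ∪ {p | ρ * (√(Var[Q p.1; P]) / √(m : ℝ))
        < |√(varianceEstimate (Q p.1) p.2) - √(Var[Q p.1; P]) / √(m : ℝ)|}

theorem measurableSet_noiseEvent {P : Measure ℝ} [IsProbabilityMeasure P] {α : ℝ} (hα : 0 < α)
    (hα1 : α < 1) (ρ : ℝ) {m : ℕ} {b : (Fin m → ℝ) → ℝ} {Q : (Fin m → ℝ) → ℝ → ℝ}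
    (hb : Measurable b) (hQ : Measurable (Function.uncurry Q)) :
    MeasurableSet (noiseEvent P α ρ b Q) := by
  have hs : Measurable fun p : (Fin m → ℝ) × (Fin m → ℝ) => √(Var[Q p.1; P]) / √(m : ℝ) :=
    ((measurable_variance_weight hQ).comp measurable_fst).sqrt.div_const _
  have hμ : Measurable fun p : (Fin m → ℝ) × (Fin m → ℝ) => ∫ u, Q p.1 u ∂P :=
    (measurable_integral_weight hQ).comp measurable_fst
  have hb' : Measurable fun p : (Fin m → ℝ) × (Fin m → ℝ) => b p.1 := hb.comp measurable_fst
  have hQi : ∀ i : Fin m, Measurable fun p : (Fin m → ℝ) × (Fin m → ℝ) => Q p.1 (p.2 i) :=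
    fun i => hQ.comp (measurable_fst.prodMk ((measurable_pi_apply i).comp measurable_snd))
  have hsum : Measurable fun p : (Fin m → ℝ) × (Fin m → ℝ) => ∑ i, Q p.1 (p.2 i) := by
    refine Finset.measurable_fun_sum _ fun i _ => ?_
    exact hQi i
  have hsum2 : Measurable fun p : (Fin m → ℝ) × (Fin m → ℝ) => ∑ i, Q p.1 (p.2 i) ^ 2 := by
    refine Finset.measurable_fun_sum _ fun i _ => ?_
    exact (hQi i).pow_const 2
  have hV : Measurable fun p : (Fin m → ℝ) × (Fin m → ℝ) => varianceEstimate (Q p.1) p.2 :=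
    (hsum2.sub ((hsum.pow_const 2).div_const _)).const_mul _
  have hq : Measurable fun p : (Fin m → ℝ) × (Fin m → ℝ) =>
      tailQuantile α (b p.1) (√(Var[Q p.1; P]) / √(m : ℝ)) :=
    measurable_tailQuantile_comp hα hα1 hb' hs
  have hN : Measurable fun p : (Fin m → ℝ) × (Fin m → ℝ) =>
      |b p.1 + ((1 / (m : ℝ)) * ∑ i, Q p.1 (p.2 i) - ∫ u, Q p.1 u ∂P)| :=
    (hb'.add ((hsum.const_mul _).sub hμ)).abs
  have hD : Measurable fun p : (Fin m → ℝ) × (Fin m → ℝ) =>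
      |√(varianceEstimate (Q p.1) p.2) - √(Var[Q p.1; P]) / √(m : ℝ)| :=
    (hV.sqrt.sub hs).abs
  unfold noiseEvent
  exact (measurableSet_lt hq hN).union (measurableSet_lt (hs.const_mul ρ) hD)

end MCEB

theorem mainTheorem2
    -- the class of effect size distributions and the true distribution
    (𝒢 : Set (Measure ℝ)) (h_prob : ∀ G' ∈ 𝒢, IsProbabilityMeasure G') (h_convex : Convex ℝ≥0 𝒢)
    (G : Measure ℝ) (hG : G ∈ 𝒢)
    -- the estimand
    (h : ℝ → ℝ) (h_meas : Measurable h) (x : ℝ)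
    (h_int : ∀ G' ∈ 𝒢, Integrable (fun μ => h μ * gaussianPDFReal 0 1 (x - μ)) G')
    -- the quantities computed from the first fold
    (M : ℝ) (hM : 0 < M)
    (fbar : ∀ m : ℕ, (Fin m → ℝ) → ℝ → ℝ) (c δ Γ Abar Fbar Q₀ : ∀ m : ℕ, (Fin m → ℝ) → ℝ)
    (Q : ∀ m : ℕ, (Fin m → ℝ) → ℝ → ℝ)
    (fbar_meas : ∀ m, Measurable (Function.uncurry (fbar m)))
    (fbar_int : ∀ m xt, Integrable (fbar m xt))
    (c_meas : ∀ m, Measurable (c m)) (c_nonneg : ∀ m xt, 0 ≤ c m xt)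
    (δ_meas : ∀ m, Measurable (δ m)) (δ_pos : ∀ m xt, 0 < δ m xt)
    (Abar_meas : ∀ m, Measurable (Abar m)) (Fbar_meas : ∀ m, Measurable (Fbar m))
    (Q₀_meas : ∀ m, Measurable (Q₀ m)) (Q_meas : ∀ m, Measurable (Function.uncurry (Q m)))
    -- the localized class and the modulus of continuity of the linearized target
    (𝒢loc : ∀ m : ℕ, (Fin m → ℝ) → Set (Measure ℝ))
    (h𝒢loc : ∀ m xt, 𝒢loc m xt = MCEB.localization M 𝒢 (fbar m xt) (c m xt))
    (Δ : ∀ m : ℕ, (Fin m → ℝ) → Measure ℝ → ℝ)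
    (hΔ : ∀ m xt, Δ m xt = MCEB.calibrationTarget h x (Abar m xt) (Fbar m xt))
    (w : ∀ m : ℕ, (Fin m → ℝ) → ℝ → ℝ)
    (hw : ∀ m xt, w m xt = MCEB.modulus M (𝒢loc m xt) (fbar m xt) (Δ m xt))
    -- the linearized target is bounded over the class
    (Δ_bdd : MCEB.WithHighProb G fun m xt => ∃ K : ℝ, ∀ G' ∈ 𝒢, |Δ m xt G'| ≤ K)
    -- the localization contains the truth and shrinks
    (loc_truth : MCEB.WithHighProb G fun m xt =>
      MCEB.supTailNorm M (fun u => MCEB.marginalDensity G u - fbar m xt u)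
        ≤ ENNReal.ofReal (c m xt))
    (c_tendsto : MCEB.TendstoZeroInProb G c)
    -- the tuning parameters
    (Γ_eq : MCEB.WithHighProb G fun m xt =>
      ∃ s : ℝ, MCEB.IsSupergradient (w m xt) (δ m xt) s ∧ Γ m xt = (m : ℝ)⁻¹ * s ^ 2)
    (δ_rate : MCEB.TendstoZeroInProb G fun m xt => c m xt ^ 2 / ((m : ℝ) * δ m xt ^ 2))
    -- the modulus problem has a solution
    (attained : MCEB.WithHighProb G fun m xt =>
      MCEB.ModulusAttained M (𝒢loc m xt) (fbar m xt) (Δ m xt) (δ m xt))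
    -- the linear estimator solves the minimax problem
    (minimax : MCEB.WithHighProb G fun m xt =>
      MCEB.IsMinimax M (𝒢loc m xt) (fbar m xt) (Δ m xt) m (Γ m xt) (Q₀ m xt) (Q m xt))
    -- rates of the pilots
    (rate_F : limsup (fun m : ℕ => ENNReal.ofReal ((m : ℝ) / √(Real.log m))
      * MCEB.mse G m (MCEB.denominator x G) (Fbar m)) atTop < ⊤)
    (rate_A : limsup (fun m : ℕ => ENNReal.ofReal (√(Real.log m))
      * MCEB.mse G m (MCEB.numerator h x G) (Abar m)) atTop = 0)
    -- the problem is at least as hard as a parametric one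
    (hard : ∃ C : ℝ, 0 < C ∧ MCEB.WithHighProb G fun m xt =>
      C / (m : ℝ) ≤ w m xt (2 / √(m : ℝ)) ^ 2) :
    ∀ η α : ℝ, 0 < η → 0 < α → α < 1 →
      ENNReal.ofReal (1 - α) ≤
        liminf (fun m : ℕ => MCEB.prob (MCEB.twoFoldLaw G m)
          {p | MCEB.posteriorExpectation h x G ∈
            MCEB.inflatedInterval α η (𝒢loc m p.1) h x (Abar m p.1) (Fbar m p.1)
              (Q₀ m p.1) (Q m p.1) p.2}) atTop := by
  intro η α hη hα hα1
  have hGp : IsProbabilityMeasure G := h_prob G hG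
  obtain rfl : 𝒢loc = fun m xt => MCEB.localization M 𝒢 (fbar m xt) (c m xt) := by
    funext m xt; exact h𝒢loc m xt
  obtain rfl : Δ = fun m xt => MCEB.calibrationTarget h x (Abar m xt) (Fbar m xt) := by
    funext m xt; exact hΔ m xt
  obtain rfl : w = fun m xt => MCEB.modulus M (MCEB.localization M 𝒢 (fbar m xt) (c m xt))
      (fbar m xt) (MCEB.calibrationTarget h x (Abar m xt) (Fbar m xt)) := by
    funext m xt; exact hw m xt
  simp only at Δ_bdd Γ_eq attained minimax hard ⊢
  obtain ⟨C, hC, hhard⟩ := hard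
  obtain ⟨κ, hκ, hmid, hleft, hright⟩ := MCEB.exists_marginalDensity_ge G hM
  have hF : 0 < MCEB.denominator x G := MCEB.marginalDensity_pos G x
  obtain ⟨ρ, hρ, hwidth⟩ := MCEB.exists_tailQuantile_add_le_halfWidth hα hα1 hη
  -- It suffices to lose an arbitrarily small amount of coverage.
  suffices hsuff : ∀ ε : ℝ, 0 < ε →
      ENNReal.ofReal (1 - α - 3 * ε) ≤
        liminf (fun m : ℕ => MCEB.prob (MCEB.twoFoldLaw G m)
          {p | MCEB.posteriorExpectation h x G ∈
            MCEB.inflatedInterval α η (MCEB.localization M 𝒢 (fbar m p.1) (c m p.1)) h x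
              (Abar m p.1) (Fbar m p.1) (Q₀ m p.1) (Q m p.1) p.2}) atTop by
    have hlim : Tendsto (fun ε : ℝ => ENNReal.ofReal (1 - α - 3 * ε)) (𝓝[>] 0)
        (𝓝 (ENNReal.ofReal (1 - α - 3 * 0))) := by
      refine tendsto_nhdsWithin_of_tendsto_nhds ?_
      exact (ENNReal.continuous_ofReal.comp (by fun_prop)).tendsto 0
    rw [mul_zero, sub_zero] at hlim
    refine le_of_tendsto hlim ?_
    filter_upwards [self_mem_nhdsWithin] with ε hε
    exact hsuff ε hε
  intro ε hε
  obtain ⟨τ, hτ, hclt⟩ := MCEB.exists_noise_bounds (MCEB.sampleLaw G) hε hρ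
  have hlin := MCEB.withHighProb_linearization hF Abar_meas Fbar_meas rate_F rate_A
    (by positivity : 0 < ρ * (√C / 4))
  -- What the first fold provides with high probability: a valid bound on the bias, weights that are
  -- small relative to their standard deviation, and a negligible linearization error.
  have hgood : MCEB.WithHighProb G fun m xt =>
      |MCEB.bias (Q₀ m xt) (Q m xt) (MCEB.calibrationTarget h x (Abar m xt) (Fbar m xt)) G|
        ≤ MCEB.worstBias (MCEB.localization M 𝒢 (fbar m xt) (c m xt))
          (MCEB.calibrationTarget h x (Abar m xt) (Fbar m xt)) (Q₀ m xt) (Q m xt) ∧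
      (∀ᵐ u ∂(MCEB.sampleLaw G),
        |Q m xt u| ≤ τ * √(Var[Q m xt; MCEB.sampleLaw G]) * √(m : ℝ)) ∧
      |MCEB.posteriorExpectation h x G - Abar m xt / Fbar m xt
          - MCEB.calibrationTarget h x (Abar m xt) (Fbar m xt) G|
        ≤ ρ * (MCEB.worstBias (MCEB.localization M 𝒢 (fbar m xt) (c m xt))
          (MCEB.calibrationTarget h x (Abar m xt) (Fbar m xt)) (Q₀ m xt) (Q m xt)
          + √(Var[Q m xt; MCEB.sampleLaw G]) / √(m : ℝ)) := by
    refine ((((((((Δ_bdd.and loc_truth).and (c_tendsto (κ / 8) (by positivity))).and Γ_eq).and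
      (δ_rate ((τ * (κ / 2) / 4) ^ 2) (by positivity))).and attained).and minimax).and
      hhard).and hlin).mono ?_
    filter_upwards [eventually_ge_atTop 2] with m hm
    have hm0 : 0 < m := by lia
    have hmpos : (0 : ℝ) < m := by exact_mod_cast hm0
    have hsm : 0 < √(m : ℝ) := Real.sqrt_pos.2 hmpos
    have hsm2 : √(m : ℝ) ^ 2 = m := Real.sq_sqrt hmpos.le
    intro xt hxt
    obtain ⟨⟨⟨⟨⟨⟨⟨⟨⟨K, hK⟩, hnear⟩, hcκ⟩, s, hs, hΓ⟩, hδc⟩, hatt⟩, hmin⟩, hhardm⟩, hlinm⟩ := hxt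
    have hc0 := c_nonneg m xt
    have hcκ' := (le_abs_self _).trans hcκ
    have hδ := δ_pos m xt
    have hP := MCEB.localProblem_localization (fbar := fbar m xt) h_prob h_convex h_int hM hκ hmid
      hleft hright
      ((fbar_meas m).comp (measurable_const.prodMk measurable_id)) (fbar_int m xt) hc0 hcκ'
      ((MCEB.supTailNorm_le_iff hc0).1 hnear) hK
    rw [hΓ] at hmin
    have hGloc : G ∈ MCEB.localization M 𝒢 (fbar m xt) (c m xt) := ⟨hG, hnear⟩
    obtain ⟨hbias, hQ, hmod⟩ := hP.minimax_bounds (by linarith) hm0 hδ hs hatt hmin hGloc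
    set σ := √(Var[Q m xt; MCEB.sampleLaw G])
    set B := MCEB.worstBias (MCEB.localization M 𝒢 (fbar m xt) (c m xt))
      (MCEB.calibrationTarget h x (Abar m xt) (Fbar m xt)) (Q₀ m xt) (Q m xt)
    have hσ0 : 0 ≤ σ := Real.sqrt_nonneg _
    refine ⟨hbias, ?_, hlinm.trans ?_⟩
    · have h1 : c m xt / (√(m : ℝ) * δ m xt) ≤ τ * (κ / 2) / 4 := by
        refine (abs_le.1 (abs_le_of_sq_le_sq ?_ (by positivity))).2
        rw [div_pow, mul_pow, hsm2]
        exact (le_abs_self _).trans hδc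
      have h2 : 4 * c m xt / (κ / 2 * δ m xt) ≤ τ * √(m : ℝ) := by
        rw [div_le_iff₀ (by positivity)] at h1 ⊢
        nlinarith
      filter_upwards [(MCEB.sampleLaw_absolutelyContinuous G).ae_le hQ] with u hu
      refine hu.trans ?_
      calc 4 * c m xt / (κ / 2 * δ m xt) * σ ≤ τ * √(m : ℝ) * σ := by gcongr
        _ = τ * σ * √(m : ℝ) := by ring
    · have h1 := hmod (2 / √(m : ℝ)) (by positivity)
      have h2 : √(C / m) ≤ MCEB.modulus M (MCEB.localization M 𝒢 (fbar m xt) (c m xt))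
          (fbar m xt) (MCEB.calibrationTarget h x (Abar m xt) (Fbar m xt)) (2 / √(m : ℝ)) :=
        (Real.sqrt_le_left (hP.modulus_nonneg hGloc _)).2 hhardm
      rw [Real.sqrt_div hC.le] at h2
      have h3 : √C / √(m : ℝ) ≤ 2 * B + 4 * (σ / √(m : ℝ)) := by
        refine (h2.trans h1).trans (le_of_eq ?_)
        ring
      have hB0 : 0 ≤ B := (abs_nonneg _).trans hbias
      calc ρ * (√C / 4) / √(m : ℝ) = ρ * (√C / √(m : ℝ) / 4) := by ring
        _ ≤ ρ * (B + σ / √(m : ℝ)) := by gcongr; linarith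
  rw [MCEB.withHighProb_iff] at hgood
  refine le_liminf_of_le (by isBoundedDefault) ?_
  filter_upwards [eventually_ge_atTop 2,
    hgood.eventually_le_const (ENNReal.ofReal_pos.2 hε)] with m hm hq
  let b : (Fin m → ℝ) → ℝ := fun xt => MCEB.bias (Q₀ m xt) (Q m xt)
    (MCEB.calibrationTarget h x (Abar m xt) (Fbar m xt)) G
  have hb : Measurable b := by
    have h1 := MCEB.measurable_integral_weight (P := MCEB.sampleLaw G) (Q_meas m)
    have h2 := Abar_meas m
    have h3 := Fbar_meas m
    have h4 := Q₀_meas m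
    simp only [b, MCEB.bias, MCEB.calibrationTarget]
    fun_prop
  have key := MCEB.le_prob_twoFoldLaw
    (cover := {p | MCEB.posteriorExpectation h x G ∈
      MCEB.inflatedInterval α η (MCEB.localization M 𝒢 (fbar m p.1) (c m p.1)) h x
        (Abar m p.1) (Fbar m p.1) (Q₀ m p.1) (Q m p.1) p.2})
    (p := ENNReal.ofReal α + ENNReal.ofReal ε + ENNReal.ofReal ε)
    (MCEB.measurableSet_noiseEvent (P := MCEB.sampleLaw G) hα hα1 ρ hb (Q_meas m)) hq
    ?_ ?_
  · refine le_trans (le_of_eq ?_) key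
    rw [← ENNReal.ofReal_add hα.le hε.le, ← ENNReal.ofReal_add (by positivity) hε.le,
      ← ENNReal.ofReal_add hε.le (by positivity), ← ENNReal.ofReal_one,
      ← ENNReal.ofReal_sub _ (by positivity)]
    congr 1
    ring
  · rintro xt ⟨-, hQ, -⟩
    obtain ⟨h1, h2⟩ := hclt m (Q m xt) (√(Var[Q m xt; MCEB.sampleLaw G])) hm
      ((Q_meas m).comp (measurable_const.prodMk measurable_id)) (Real.sqrt_nonneg _)
      (Real.sq_sqrt (variance_nonneg _ _)).symm hQ
    refine (measure_union_le _ _).trans (add_le_add ?_ h2)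
    refine (h1 (b xt) (MCEB.tailQuantile α (b xt)
      (√(Var[Q m xt; MCEB.sampleLaw G]) / √(m : ℝ)))).trans ?_
    gcongr
    exact MCEB.absTail_tailQuantile_le hα _ _
  · rintro xt X ⟨hbB, -, he⟩ hX
    simp only [MCEB.noiseEvent, Set.mem_union, Set.mem_ofPred_eq, not_or, not_lt] at hX
    exact MCEB.mem_inflatedInterval hX.1
      (hwidth _ _ _ _ _ hbB (by positivity) hX.2 he)
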